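/- Let $\mathfrak g$ be a finite-dimensional real semisimple Lie algebra with Killing form $\langle\cdot,\cdot\rangle$. Let $U\subseteq\mathfrak g\times\mathfrak g\times\mathfrak g$ be an open set (for instance the whole space) that is invariant under the action $(a,b,c)\mapsto(a,b,c)O$ of $SO(3)$, and let $A:U\to S^2(\mathfrak g)$ be a smooth $SO(3)$-invariant function. For $\xi,\eta\in\mathfrak g$ let $A_{\xi,\eta}$ be the contraction of $A$ with $\xi$ and $\eta$ by means of the Killing form, and let $A^\#\xi\in\mathfrak g$ be defined by $\langle A^\#\xi,\eta\rangle=A_{\xi,\eta}$. Write $l^1_\xi(a,b,c)=\langle\xi,a\rangle$, $l^2_\xi(a,b,c)=\langle\xi,b\rangle$, $l^3_\xi(a,b,c)=\langle\xi,c\rangle$, and let $\pi$ be the bivector field on $U$ with $$\{l^1_\xi,l^1_\eta\}=l^1_{[\xi,\eta]},\quad \{l^1_\xi,l^j_\eta\}=\{l^j_\xi,l^1_\eta\}=l^j_{[\xi,\eta]},\quad \{l^j_\xi,l^j_\eta\}=-l^1_{[\xi,\eta]}\ (j=2,3),\quad \{l^2_\xi,l^3_\eta\}=-\{l^3_\xi,l^2_\eta\}=A_{\xi,\eta}.$$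 Assume that $\pi$ is a Poisson structure. Give $\mathfrak{su}(2)$ the Euclidean inner product $\langle\cdot,\cdot\rangle$ that is minus its Killing form, and fix an orientation of $\mathfrak{su}(2)$. A frame is an orthonormal basis $F=\{e_1,e_2,e_3\}$ of $\mathfrak{su}(2)$ of the fixed orientation. A frame identifies $L(\mathfrak g,\mathfrak{su}(2))$ with $\mathfrak g\times\mathfrak g\times\mathfrak g$: the triple $(a,b,c)$ corresponds to the map $\xi\mapsto\langle a,\xi\rangle e_1+\langle b,\xi\rangle e_2+\langle c,\xi\rangle e_3$. Let $M\subseteq L(\mathfrak g,\mathfrak{su}(2))$ be the open set that corresponds to $U$ (it does not depend on the frame) and let $\pi_F$ be the Poisson structure on $M$ that corresponds to $\pi$. Write $F_1=F=\{e_1,e_2,e_3\}$, $F_2=\{e_2,e_3,e_1\}$, $F_3=\{e_3,e_1,e_2\}$. A hypersymplectic structure on a manifold $S$ is a closed $\mathfrak{su}(2)$-valued $2$-form $\Omega$ on $S$ such that $\omega_\xi=\langle\xi,\Omega\rangle$ is nondegenerate for every $\xi\ne0$ and such that $\xi\mapsto\omega_\xi^{-1}$ is linear on unit vectors: $\omega_\xi^{-1}=k_1\omega_{\xi_1}^{-1}+k_2\omega_{\xi_2}^{-1}$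 whenever $\xi,\xi_1,\xi_2$ are unit vectors with $\xi=k_1\xi_1+k_2\xi_2$, $k_1,k_2\in\mathbb R$. Then the following two statements are equivalent. (1) The symplectic foliation of $\pi_F$ on $M$ (its leaves together with their tangent spaces) is the same for all frames $F$, and on each leaf the induced family of symplectic forms is hypersymplectic: there is a hypersymplectic structure $\Omega$ on the leaf with $\Omega=\omega_1e_1+\omega_2e_2+\omega_3e_3$ for every frame $F=\{e_1,e_2,e_3\}$, where $\omega_i$ is the symplectic form that $\pi_{F_i}$ induces on the leaf. (2) For every $(a,b,c)\in U$ and every $\xi\in\mathfrak g$ the linear system $$\begin{cases} A^\#u+[v,c]-[w,b]=[\xi,a]\\ -[u,c]+A^\#v+[w,a]=[\xi,b]\\ [u,b]-[v,a]+A^\#w=[\xi,c]\\ -[u,a]-[v,b]-[w,c]=A^\#\xi\end{cases}$$ has a solution $(u,v,w)\in\mathfrak g\times\mathfrak g\times\mathfrak g$, where $A^\#$ is taken at the point $(a,b,c)$. -/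

import Mathlib

open scoped ContDiff

noncomputable section

/-! ### Bivector fields and Poisson structures on a finite-dimensional vector space -/

/-- A bivector field on the vector space `V`, as a field of bilinear forms on the cotangent spaces
(every cotangent space of `V` is the dual of `V`).  Skewness is imposed separately. -/
abbrev BivectorField (V : Type*) [AddCommGroup V] [Module ℝ V] : Type _ :=
  V → Module.Dual ℝ V →ₗ[ℝ] Module.Dual ℝ V →ₗ[ℝ] ℝ

namespace BivectorField

/-- The pull-back of a bivector field under a linear isomorphism. -/
def pullback {V V' : Type*} [AddCommGroup V] [Module ℝ V] [AddCommGroup V'] [Module ℝ V']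
    (e : V ≃ₗ[ℝ] V') (π : BivectorField V') : BivectorField V := fun m =>
  (π (e m)).compl₁₂ (e.symm.dualMap : Module.Dual ℝ V →ₗ[ℝ] Module.Dual ℝ V')
    (e.symm.dualMap : Module.Dual ℝ V →ₗ[ℝ] Module.Dual ℝ V')

section Linear

variable {V : Type*} [AddCommGroup V] [Module ℝ V] [FiniteDimensional ℝ V]

/-- The bundle map `π^# : T^*V → TV`, characterised by `β (π^# α) = π(α, β)`. -/
def sharp (π : BivectorField V) (m : V) : Module.Dual ℝ V →ₗ[ℝ] V :=
  ((Module.evalEquiv ℝ V).symm : Module.Dual ℝ (Module.Dual ℝ V) →ₗ[ℝ] V) ∘ₗ π m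

/-- The symplectic distribution `π^# (T^*V)`: its value at `m` is the tangent space at `m` of the
symplectic leaf through `m`. -/
def dist (π : BivectorField V) (m : V) : Submodule ℝ V := LinearMap.range (π.sharp m)

end Linear

section Smooth

variable {V : Type*} [NormedAddCommGroup V] [NormedSpace ℝ V]

/-- The bracket `{f, h} = π(df, dh)`. -/
def bracket (π : BivectorField V) (f h : V → ℝ) (m : V) : ℝ :=
  π m (fderiv ℝ f m : V →ₗ[ℝ] ℝ) (fderiv ℝ h m : V →ₗ[ℝ] ℝ)

/-- `π` is a (smooth) Poisson structure on the open set `W`. -/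
structure IsPoissonOn (π : BivectorField V) (W : Set V) : Prop where
  smooth : ∀ α β : Module.Dual ℝ V, ContDiffOn ℝ ∞ (fun m => π m α β) W
  skew : ∀ m ∈ W, ∀ α β : Module.Dual ℝ V, π m α β = - π m β α
  jacobi : ∀ f h k : V → ℝ, ContDiffOn ℝ ∞ f W → ContDiffOn ℝ ∞ h W → ContDiffOn ℝ ∞ k W →
    ∀ m ∈ W, π.bracket (π.bracket f h) k m + π.bracket (π.bracket h k) f m +
      π.bracket (π.bracket k f) h m = 0

end Smooth

end BivectorField

/-! ### Integral manifolds and leaves -/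

section Leaves

variable {V : Type*} [NormedAddCommGroup V] [NormedSpace ℝ V]

/-- A chart of a leaf of the distribution `D` on `W`: a smooth injective immersion
`φ` of a connected open subset `S` of `ℝᵏ` into `W` which is everywhere tangent to `D` and has the
full dimension of `D`. -/
structure IsLeafChart (D : V → Submodule ℝ V) (W : Set V) {k : ℕ}
    (S : Set (EuclideanSpace ℝ (Fin k))) (φ : EuclideanSpace ℝ (Fin k) → V) : Prop where
  isOpen : IsOpen S
  preconnected : IsPreconnected S
  mapsTo : Set.MapsTo φ S W
  smooth : ContDiffOn ℝ ∞ φ S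
  injOn : Set.InjOn φ S
  immersion : ∀ s ∈ S, Function.Injective (fderiv ℝ φ s)
  range_eq : ∀ s ∈ S, LinearMap.range (fderiv ℝ φ s : EuclideanSpace ℝ (Fin k) →ₗ[ℝ] V) = D (φ s)

/-- Two points lie in the image of one and the same leaf chart. -/
def InCommonChart (D : V → Submodule ℝ V) (W : Set V) (x y : V) : Prop :=
  ∃ (k : ℕ) (S : Set (EuclideanSpace ℝ (Fin k))) (φ : EuclideanSpace ℝ (Fin k) → V),
    IsLeafChart D W S φ ∧ x ∈ φ '' S ∧ y ∈ φ '' S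

/-- The leaf through `m`, i.e. the maximal connected integral manifold of `D` through `m`:
the points that can be joined to `m` by a finite chain of leaf charts. -/
def leaf (D : V → Submodule ℝ V) (W : Set V) (m : V) : Set V :=
  {x | Relation.ReflTransGen (InCommonChart D W) m x}

end Leaves

/-! ### The Euclidean space `su(2)`, hypersymplectic structures -/

section SU2

attribute [local instance] LieRing.ofAssociativeRing

/-- The real Lie algebra `su(2)` of trace-free skew-Hermitian complex `2 × 2` matrices. -/
def su2 : LieSubalgebra ℝ (Matrix (Fin 2) (Fin 2) ℂ) where
  carrier := {X | X.conjTranspose = -X ∧ X.trace = 0}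
  add_mem' := by
    rintro X Y ⟨hX, hX'⟩ ⟨hY, hY'⟩
    exact ⟨by rw [Matrix.conjTranspose_add, hX, hY, neg_add], by
      rw [Matrix.trace_add, hX', hY', add_zero]⟩
  zero_mem' := by simp
  smul_mem' := by
    rintro c X ⟨hX, hX'⟩
    exact ⟨by rw [Matrix.conjTranspose_smul, hX, smul_neg, star_trivial], by
      rw [Matrix.trace_smul, hX', smul_zero]⟩
  lie_mem' := by
    rintro X Y ⟨hX, _⟩ ⟨hY, _⟩
    refine ⟨?_, ?_⟩
    · rw [Ring.lie_def, Matrix.conjTranspose_sub, Matrix.conjTranspose_mul,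
        Matrix.conjTranspose_mul, hX, hY]
      simp
    · rw [Ring.lie_def, Matrix.trace_sub, Matrix.trace_mul_comm, sub_self]

end SU2

/-- The Euclidean inner product on `su(2)` given by the Killing form.  The Killing form of `su(2)`
is negative definite, so its sign is changed. -/
def su2Inner : LinearMap.BilinForm ℝ su2 := - killingForm ℝ su2

/-- For an `su(2)`-valued bilinear form `Ω` on `T`, the map `ω_ξ^♭ : T → T^*` belonging to the
scalar form `ω_ξ = ⟨ξ, Ω⟩`. -/
def flat {T : Type*} [AddCommGroup T] [Module ℝ T] (Ω : T →ₗ[ℝ] T →ₗ[ℝ] su2) (ξ : su2) :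
    T →ₗ[ℝ] Module.Dual ℝ T := Ω.compr₂ (su2Inner ξ)

/-- The pointwise part of the definition of a hypersymplectic structure, on one tangent space `T`:
`Ω` is an `su(2)`-valued 2-form, `ω_ξ = ⟨ξ, Ω⟩` is nondegenerate for all `ξ ≠ 0`, and
`ξ ↦ ω_ξ⁻¹` is linear on the unit sphere. -/
structure IsHypersymplecticAt {T : Type*} [AddCommGroup T] [Module ℝ T]
    (Ω : T →ₗ[ℝ] T →ₗ[ℝ] su2) : Prop where
  alternating : ∀ v : T, Ω v v = 0
  nondegenerate : ∀ ξ : su2, ξ ≠ 0 → Function.Bijective (flat Ω ξ)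
  inverse_linear : ∀ (ξ ξ₁ ξ₂ : su2) (k₁ k₂ : ℝ),
    su2Inner ξ ξ = 1 → su2Inner ξ₁ ξ₁ = 1 → su2Inner ξ₂ ξ₂ = 1 → ξ = k₁ • ξ₁ + k₂ • ξ₂ →
    ∀ (α : Module.Dual ℝ T) (v v₁ v₂ : T),
      flat Ω ξ v = α → flat Ω ξ₁ v₁ = α → flat Ω ξ₂ v₂ = α → v = k₁ • v₁ + k₂ • v₂

/-- `Ω`, an `su(2)`-valued form on the tangent spaces `D m` of a leaf `L` of the distribution `D`
on `W`, is a hypersymplectic structure on `L`: it satisfies the pointwise conditions on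
every tangent space, and in every chart of `L` it is a smooth closed form, which means that all the
components `⟨ξ, Ω⟩` are smooth and closed. -/
structure IsHypersymplecticOnLeaf {V : Type*} [NormedAddCommGroup V] [NormedSpace ℝ V]
    (D : V → Submodule ℝ V) (W : Set V) (L : Set V)
    (Ω : (m : V) → D m →ₗ[ℝ] D m →ₗ[ℝ] su2) : Prop where
  pointwise : ∀ m ∈ L, IsHypersymplecticAt (Ω m)
  closed : ∀ (k : ℕ) (S : Set (EuclideanSpace ℝ (Fin k))) (φ : EuclideanSpace ℝ (Fin k) → V),
    IsLeafChart D W S φ → φ '' S ⊆ L → ∀ ξ : su2,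
    ∃ η : EuclideanSpace ℝ (Fin k) → EuclideanSpace ℝ (Fin k) [⋀^Fin 2]→L[ℝ] ℝ,
      (∀ s ∈ S, ∀ (x y : EuclideanSpace ℝ (Fin k)) (u v : D (φ s)),
        (u : V) = fderiv ℝ φ s x → (v : V) = fderiv ℝ φ s y →
          η s ![x, y] = su2Inner ξ (Ω (φ s) u v)) ∧
      ContDiffOn ℝ ∞ η S ∧ ∀ s ∈ S, extDeriv η s = 0

/-- A frame: an orthonormal basis of `su(2)`. -/
structure Frame where
  basis : Module.Basis (Fin 3) ℝ su2
  orthonormal : ∀ i j, su2Inner (basis i) (basis j) = if i = j then 1 else 0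

/-- The cyclically permuted frames: for `F = {e₁, e₂, e₃}`, the frames `F.cycle 0`, `F.cycle 1`,
`F.cycle 2` are `{e₁, e₂, e₃}`, `{e₂, e₃, e₁}`, `{e₃, e₁, e₂}`. -/
def Frame.cycle (F : Frame) (i : Fin 3) : Frame where
  basis := F.basis.reindex (Equiv.subRight i)
  orthonormal := by
    intro j k
    simp [F.orthonormal]

/-! ### The spaces `𝔤 × 𝔤 × 𝔤` and `L(𝔤, su(2))` -/

section Spaces

variable (g : Type*) [LieRing g] [LieAlgebra ℝ g]

/-- The space `𝔤 × 𝔤 × 𝔤`; the components of `p` are `p 0`, `p 1`, `p 2`. -/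
def Triple : Type _ := Fin 3 → g

/-- The space `M = L(𝔤, su(2))` of all linear maps. -/
def HomSU2 : Type _ := g →ₗ[ℝ] su2

instance : AddCommGroup (Triple g) := inferInstanceAs (AddCommGroup (Fin 3 → g))
instance : Module ℝ (Triple g) := inferInstanceAs (Module ℝ (Fin 3 → g))
instance : AddCommGroup (HomSU2 g) := inferInstanceAs (AddCommGroup (g →ₗ[ℝ] su2))
instance : Module ℝ (HomSU2 g) := inferInstanceAs (Module ℝ (g →ₗ[ℝ] su2))

variable [FiniteDimensional ℝ g]

instance : FiniteDimensional ℝ (Triple g) := inferInstanceAs (FiniteDimensional ℝ (Fin 3 → g))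
instance : FiniteDimensional ℝ (HomSU2 g) := inferInstanceAs (FiniteDimensional ℝ (g →ₗ[ℝ] su2))

/- Both spaces carry the standard topology and smooth structure of a finite-dimensional real vector
space; as all norms are equivalent, it does not matter which norm is used to describe them. -/
instance : NormedAddCommGroup (Triple g) :=
  NormedAddCommGroup.induced (Triple g) (Fin (Module.finrank ℝ (Triple g)) → ℝ)
    (Module.finBasis ℝ (Triple g)).equivFun (Module.finBasis ℝ (Triple g)).equivFun.injective
instance : NormedSpace ℝ (Triple g) :=
  NormedSpace.induced ℝ (Triple g) (Fin (Module.finrank ℝ (Triple g)) → ℝ)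
    (Module.finBasis ℝ (Triple g)).equivFun
instance : NormedAddCommGroup (HomSU2 g) :=
  NormedAddCommGroup.induced (HomSU2 g) (Fin (Module.finrank ℝ (HomSU2 g)) → ℝ)
    (Module.finBasis ℝ (HomSU2 g)).equivFun (Module.finBasis ℝ (HomSU2 g)).equivFun.injective
instance : NormedSpace ℝ (HomSU2 g) :=
  NormedSpace.induced ℝ (HomSU2 g) (Fin (Module.finrank ℝ (HomSU2 g)) → ℝ)
    (Module.finBasis ℝ (HomSU2 g)).equivFun

end Spaces

section Hyper

variable {g : Type*} [LieRing g] [LieAlgebra ℝ g] [FiniteDimensional ℝ g]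
  [LieAlgebra.IsSemisimple ℝ g]

/-- The right action of `3 × 3` matrices on triples, `(a, b, c) ↦ (a, b, c) O`. -/
def Triple.act (p : Triple g) (O : Matrix (Fin 3) (Fin 3) ℝ) : Triple g :=
  fun j => ∑ i, O i j • p i

/-- The identification of `𝔤` with its dual by the Killing form. -/
def killingDual : g ≃ₗ[ℝ] Module.Dual ℝ g :=
  (killingForm ℝ g).toDual (LieAlgebra.IsKilling.killingForm_nondegenerate ℝ g)

/-- For a symmetric tensor on `𝔤`, viewed as a bilinear form `B` on `𝔤`, the contraction `B^# u`:
the element of `𝔤` with `⟨B^# u, v⟩ = B(u, v)` for all `v`. -/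
def contract (B : LinearMap.BilinForm ℝ g) (u : g) : g := killingDual.symm (B u)

/-- For `x : 𝔤`, the bilinear form `(ξ, η) ↦ ⟨[ξ, η], x⟩`. -/
def lieForm (x : g) : LinearMap.BilinForm ℝ g :=
  LinearMap.mk₂ ℝ (fun ξ η => killingForm ℝ g ⁅ξ, η⁆ x) (by simp) (by simp) (by simp) (by simp)

/-- The brackets of the linear functions `l^i_ξ (p) = ⟨ξ, p i⟩` at the point `p`: the entry
`(i, j)` is the bilinear form `(ξ, η) ↦ {l^i_ξ, l^j_η} (p)`. -/
def bracketTable (A : Triple g → LinearMap.BilinForm ℝ g) (p : Triple g) :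
    Matrix (Fin 3) (Fin 3) (LinearMap.BilinForm ℝ g) :=
  !![lieForm (p 0), lieForm (p 1),  lieForm (p 2);
     lieForm (p 1), -lieForm (p 0), A p;
     lieForm (p 2), -A p,           -lieForm (p 0)]

/-- The element `ξ_i` of `𝔤` in the unique expansion `α = l^1_{ξ_1} + l^2_{ξ_2} + l^3_{ξ_3}`
of a covector `α` of `𝔤 × 𝔤 × 𝔤`. -/
def covectorComponent (i : Fin 3) : Module.Dual ℝ (Triple g) →ₗ[ℝ] g :=
  ((killingDual (g := g)).symm : Module.Dual ℝ g →ₗ[ℝ] g) ∘ₗ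
    Module.Dual.transpose (R := ℝ) (LinearMap.single ℝ (fun _ : Fin 3 => g) i : g →ₗ[ℝ] Triple g)

/-- The bivector field `π` on `𝔤 × 𝔤 × 𝔤` with the prescribed brackets of linear functions. -/
def tripleBivector (A : Triple g → LinearMap.BilinForm ℝ g) : BivectorField (Triple g) := fun p =>
  ∑ i, ∑ j, (bracketTable A p i j).compl₁₂ (covectorComponent i) (covectorComponent j)

/-- The identification `Ψ_F : L(𝔤, su(2)) ≃ 𝔤 × 𝔤 × 𝔤` given by a frame: `m` corresponds
to `(a, b, c)` when `m(ξ) = ⟨a, ξ⟩ e₁ + ⟨b, ξ⟩ e₂ + ⟨c, ξ⟩ e₃`. -/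
def Frame.identify (F : Frame) : HomSU2 g ≃ₗ[ℝ] Triple g where
  toFun m := fun i => killingDual.symm ((F.basis.coord i) ∘ₗ (m : g →ₗ[ℝ] su2))
  map_add' m n := by
    funext i
    exact (congrArg killingDual.symm (LinearMap.comp_add _ _ _)).trans (map_add _ _ _)
  map_smul' c m := by
    funext i
    exact (congrArg killingDual.symm (LinearMap.comp_smul _ _ _)).trans (map_smul _ _ _)
  invFun p := (∑ i, (killingDual (p i)).smulRight (F.basis i) : g →ₗ[ℝ] su2)
  left_inv m := by
    refine @LinearMap.ext ℝ ℝ g su2 _ _ _ _ _ _ _ _ _ fun x => ?_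
    refine (LinearMap.sum_apply _ _ _).trans ?_
    simp only [LinearEquiv.apply_symm_apply, LinearMap.smulRight_apply]
    exact F.basis.sum_repr _
  right_inv p := by
    funext i
    refine (LinearEquiv.symm_apply_eq _).2 (LinearMap.ext fun x => ?_)
    refine (congrArg (F.basis.coord i) (LinearMap.sum_apply _ _ _)).trans ?_
    simp [Finsupp.single_apply]

/-- The bivector field `π_F` on `L(𝔤, su(2))`. -/
def Frame.bivector (F : Frame) (A : Triple g → LinearMap.BilinForm ℝ g) :
    BivectorField (HomSU2 g) := (tripleBivector A).pullback F.identify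

/-- The part `M_U` of `L(𝔤, su(2))` that corresponds to `U ⊆ 𝔤 × 𝔤 × 𝔤`. -/
def Frame.domain (F : Frame) (U : Set (Triple g)) : Set (HomSU2 g) := F.identify ⁻¹' U

/-- The symplectic leaf of `π_F` on `M_U` through `m`. -/
def Frame.leaf (F : Frame) (A : Triple g → LinearMap.BilinForm ℝ g) (U : Set (Triple g))
    (m : HomSU2 g) : Set (HomSU2 g) := _root_.leaf (F.bivector A).dist (F.domain U) m

/-- The symplectic foliations of `π_F` and `π_T` on `M_U` coincide: the leaves through every
point are the same, and have the same tangent spaces. -/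
def SameFoliation (A : Triple g → LinearMap.BilinForm ℝ g) (U : Set (Triple g))
    (F T : Frame) : Prop :=
  ∀ m ∈ F.domain U, F.leaf A U m = T.leaf A U m ∧
    (F.bivector A).dist m = (T.bivector A).dist m

/-- `⟨ξ, Ω⟩`, for a form `Ω` on the tangent spaces `D m` of a leaf `L`, is the symplectic form `ω`
which the Poisson structure `π` induces on `L`; this means that `ω(π^# α, v) = α(v)`. -/
def IsInducedForm {V : Type*} [AddCommGroup V] [Module ℝ V] [FiniteDimensional ℝ V]
    (π : BivectorField V) (D : V → Submodule ℝ V) (L : Set V)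
    (Ω : (m : V) → D m →ₗ[ℝ] D m →ₗ[ℝ] su2) (ξ : su2) : Prop :=
  ∀ m ∈ L, ∀ (α : Module.Dual ℝ V) (u v : D m), π.sharp m α = u → su2Inner ξ (Ω m u v) = α v

/-- The leaf of `π_F` through `m`, with the family of symplectic forms induced by the Poisson
structures `π_T`, for the frames `T` of orientation `o`, is hypersymplectic: there is a
hypersymplectic structure `Ω` on the leaf such that, for all these frames
`T = {e₁, e₂, e₃}`, `Ω = ω₁ e₁ + ω₂ e₂ + ω₃ e₃` where `ω_i` is the symplectic form
induced by the Poisson structure of the `i`-th cyclic permutation of `T`. -/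
def HypersymplecticLeaf (o : Orientation ℝ su2 (Fin 3)) (A : Triple g → LinearMap.BilinForm ℝ g)
    (U : Set (Triple g)) (F : Frame) (m : HomSU2 g) : Prop :=
  ∃ Ω : (x : HomSU2 g) → (F.bivector A).dist x →ₗ[ℝ] (F.bivector A).dist x →ₗ[ℝ] su2,
    IsHypersymplecticOnLeaf (F.bivector A).dist (F.domain U) (F.leaf A U m) Ω ∧
    ∀ T : Frame, T.basis.orientation = o → ∀ i : Fin 3,
      IsInducedForm ((T.cycle i).bivector A) (F.bivector A).dist (F.leaf A U m) Ω (T.basis i)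

/-- The triple `(u, v, w)` solves the linear system belonging to `(a, b, c)` and `ξ`; here `B` is
the value of the tensor `A` at `(a, b, c)`. -/
def SolvesSystem (B : LinearMap.BilinForm ℝ g) (a b c ξ u v w : g) : Prop :=
  contract B u + ⁅v, c⁆ - ⁅w, b⁆ = ⁅ξ, a⁆ ∧
  -⁅u, c⁆ + contract B v + ⁅w, a⁆ = ⁅ξ, b⁆ ∧
  ⁅u, b⁆ - ⁅v, a⁆ + contract B w = ⁅ξ, c⁆ ∧
  -⁅u, a⁆ - ⁅v, b⁆ - ⁅w, c⁆ = contract B ξ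

end Hyper

end

noncomputable section

/-! ### The symplectic form of a Poisson structure on a leaf is smooth and closed -/

open Filter Topology

namespace BivectorField

section Sharp

variable {V : Type*} [AddCommGroup V] [Module ℝ V] [FiniteDimensional ℝ V]

/-! The brackets of π_F can be written so that the frame enters only through its first vector e₁, on
which they depend linearly, and its orientation (`bivector_pairing`); SO(3)-invariance of A is what
makes the tensor term independent of the frame. So the maps π_F^# are the values at unit vectors of
one linear family P_z, z ∈ su(2) (`sharpFamily`). Apart from closedness, the theorem is linear
algebra about this family at each point.

Read a covector as an element ξ of Im ℍ ⊗ 𝔤 and let Q be left multiplication by A^# + ia + jb + kc,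
where a, b, c act by brackets. Then P_z ξ = -Im(Q(ξ)z) (`identify_sharpFamily`), Q commutes with
right multiplications, and the linear system is Q(ξ + iu + jv + kw) = 0 (`solvesSystem_iff`). Hence
(2) says that ker Q projects onto the real part 𝔤. As Q is symmetric for the Killing form, (2)
implies that Im(Qx) = 0 forces Qx = 0 (`quatLeft_eq_zero`).

Assume (2). If P_z ξ = 0 with |z| = 1, then Q(ξ)z = 0, so Q(ξ) = 0 and every P_w kills ξ: all
kernels agree, hence, by skewness, all ranges and all leaves. If P_z β = P_{e_i} α_i for all i, then
y = Q(β)z = Q(α_i)e_i, so Q(β) = -yz = ∑ z_i Q(α_i). Thus the inverses of the P_z are linear in z,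
and Ω = ∑ ω_i e_i is pointwise hypersymplectic (`exists_isHypersymplecticAt`). Each ω_i is smooth
and closed by the Jacobi identity (`exists_closed_form`).

Conversely, linearity of the symplectic forms at (e₁ + e₂)/√2 gives, for every α, some α' with
P_{e₁}α = P_{e₂}α' and P_{e₂}α = -P_{e₁}α'. For α = -kξ these relations produce an element of ker Q
with real part ξ (`exists_solvesSystem`). -/

theorem dual_sharp (π : BivectorField V) (m : V) (α β : Module.Dual ℝ V) :
    β (π.sharp m α) = π m α β := by
  unfold sharp
  simp only [LinearMap.comp_apply, LinearEquiv.coe_coe]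
  exact Module.apply_evalEquiv_symm_apply ..

/-- By skewness α(π^#β) = -β(π^#α) depends on α only through π^#α. This makes the symplectic form of
a leaf well defined. -/
theorem dual_eq_of_sharp_eq {π : BivectorField V} {m : V}
    (hskew : ∀ α β : Module.Dual ℝ V, π m α β = -π m β α) {α α' : Module.Dual ℝ V}
    (h : π.sharp m α = π.sharp m α') {v : V} (hv : v ∈ π.dist m) : α v = α' v := by
  obtain ⟨β, rfl⟩ := hv
  rw [dual_sharp, dual_sharp, hskew β α, hskew β α', ← dual_sharp, ← dual_sharp, h]

/-- A bilinear form on `E` representing the symplectic form of a leaf, pulled back along an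
immersion with derivative `d`. -/
theorem exists_pullback_form {E : Type*} [NormedAddCommGroup E] [NormedSpace ℝ E]
    [FiniteDimensional ℝ E] {π : BivectorField V} {m : V}
    (hskew : ∀ α β : Module.Dual ℝ V, π m α β = -π m β α) (d : E →ₗ[ℝ] V)
    (hd : LinearMap.range d = π.dist m) :
    ∃ B : E →L[ℝ] E →L[ℝ] ℝ, ∀ (x y : E) (α : Module.Dual ℝ V),
      π.sharp m α = d x → B x y = α (d y) := by
  -- A linear section τ of π^# makes the choice of α linear in x; the form does not depend on it.
  obtain ⟨τ, hτ⟩ := (π.sharp m).rangeRestrict.exists_rightInverse_of_surjective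
    (LinearMap.range_rangeRestrict _)
  have hmem : ∀ x, d x ∈ LinearMap.range (π.sharp m) := fun x => by
    have := LinearMap.mem_range_self d x
    rw [hd] at this
    exact this
  let d' : E →ₗ[ℝ] LinearMap.range (π.sharp m) := d.codRestrict _ hmem
  let B₀ : E →ₗ[ℝ] E →ₗ[ℝ] ℝ := (τ ∘ₗ d').compl₂ d
  refine ⟨LinearMap.toContinuousLinearMap
    ((LinearMap.toContinuousLinearMap : (E →ₗ[ℝ] ℝ) ≃ₗ[ℝ] E →L[ℝ] ℝ).toLinearMap ∘ₗ B₀),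
    fun x y α h => ?_⟩
  have h1 : π.sharp m (τ (d' x)) = d x := congrArg Subtype.val (LinearMap.congr_fun hτ (d' x))
  exact dual_eq_of_sharp_eq hskew (h1.trans h.symm) (hmem y)

end Sharp

end BivectorField

/-! ### Lifting vector fields and differentiating forms along an immersion -/

section Calculus

variable {E V : Type*} [NormedAddCommGroup E] [NormedSpace ℝ E] [FiniteDimensional ℝ E]
  [NormedAddCommGroup V] [NormedSpace ℝ V] [FiniteDimensional ℝ V]

omit [FiniteDimensional ℝ E] in
theorem contDiffOn_of_dual {n : ℕ∞ω} {f : E → V} {S : Set E}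
    (h : ∀ β : Module.Dual ℝ V, ContDiffOn ℝ n (fun s => β (f s)) S) : ContDiffOn ℝ n f S := by
  have : f = fun s => ∑ i, (Module.finBasis ℝ V).coord i (f s) • Module.finBasis ℝ V i := by
    funext s
    exact ((Module.finBasis ℝ V).sum_repr (f s)).symm
  rw [this]
  exact ContDiffOn.sum fun i _ => (h _).smul contDiffOn_const

/-- A smooth vector field along an immersion that is tangent to it lifts smoothly. -/
theorem exists_smooth_lift {D : E → E →L[ℝ] V} {Y : E → V} {s₀ : E}
    (hD : ContDiffAt ℝ ∞ D s₀) (hinj : Function.Injective (D s₀)) (hY : ContDiffAt ℝ ∞ Y s₀)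
    (hmem : ∀ᶠ s in 𝓝 s₀, ∃ x, D s x = Y s) :
    ∃ X : E → E, ContDiffAt ℝ ∞ X s₀ ∧ ∀ᶠ s in 𝓝 s₀, D s (X s) = Y s := by
  -- With L a left inverse of D s₀, the operator L ∘ D s is invertible near s₀, and the lift is (L ∘
  -- D s)⁻¹ L (Y s).
  obtain ⟨L₀, hL₀⟩ := (D s₀ : E →ₗ[ℝ] V).exists_leftInverse_of_injective
    (LinearMap.ker_eq_bot.2 hinj)
  let L : V →L[ℝ] E := LinearMap.toContinuousLinearMap L₀
  let N : E → E →L[ℝ] E := fun s => L.comp (D s)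
  have hN : ContDiffAt ℝ ∞ N s₀ := contDiffAt_const.clm_comp hD
  have hN₀ : N s₀ = 1 := by
    ext x
    exact LinearMap.congr_fun hL₀ x
  have hinv : ContDiffAt ℝ ∞ (fun s => Ring.inverse (N s)) s₀ := by
    refine ContDiffAt.comp s₀ (g := Ring.inverse) ?_ hN
    rw [hN₀]
    exact contDiffAt_ringInverse ℝ (1 : (E →L[ℝ] E)ˣ)
  have hunit : ∀ᶠ s in 𝓝 s₀, IsUnit (N s) :=
    hN.continuousAt.eventually (Units.isOpen.mem_nhds (by simp [hN₀]))
  refine ⟨fun s => Ring.inverse (N s) (L (Y s)), hinv.clm_apply (L.contDiff.contDiffAt.comp _ hY),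
    ?_⟩
  filter_upwards [hunit, hmem] with s hs ⟨x, hx⟩
  have h1 : Ring.inverse (N s) (N s x) = x := by
    rw [← mul_apply_eq_comp, Ring.inverse_mul_cancel _ hs]
    rfl
  have h2 : L (Y s) = N s x := by rw [← hx]; rfl
  rw [h2, h1, hx]

/-- A bilinear form which is smooth on a local frame is smooth. -/
theorem contDiffAt_form {ι : Type*} [Fintype ι] (b : Module.Basis ι ℝ E)
    {B : E → E →L[ℝ] E →L[ℝ] ℝ} {X : ι → E → E} {s : E} (hX : ∀ i, ContDiffAt ℝ ∞ (X i) s)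
    (hX₀ : ∀ i, X i s = b i) {f : ι → E → ℝ} (hf : ∀ i, ContDiffAt ℝ ∞ (f i) s) (x y : E)
    (hB : ∀ᶠ t in 𝓝 s, ∀ i, B t (X i t) y = f i t) :
    ContDiffAt ℝ ∞ (fun t => B t x y) s := by
  let c : ∀ i, E →L[ℝ] ℝ := fun i => LinearMap.toContinuousLinearMap (b.coord i)
  -- T t sends b i to X i t and is the identity at s, so x = ∑ c i ((T t)⁻¹ x) • X i t near s.
  let T : E → E →L[ℝ] E := fun t => ∑ i, (c i).smulRight (X i t)
  have hT : ContDiffAt ℝ ∞ T s :=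
    ContDiffAt.sum fun i _ => ContDiffAt.comp (g := ContinuousLinearMap.smulRightL ℝ E E (c i)) s
      (ContinuousLinearMap.smulRightL ℝ E E (c i)).contDiff.contDiffAt (hX i)
  have hT₀ : T s = 1 := by
    ext1 v
    simp only [T, sum_apply, ContinuousLinearMap.smulRight_apply, hX₀]
    exact b.sum_repr v
  have hinv : ContDiffAt ℝ ∞ (fun t => Ring.inverse (T t)) s := by
    refine ContDiffAt.comp s (g := Ring.inverse) ?_ hT
    rw [hT₀]
    exact contDiffAt_ringInverse ℝ (1 : (E →L[ℝ] E)ˣ)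
  have hunit : ∀ᶠ t in 𝓝 s, IsUnit (T t) :=
    hT.continuousAt.eventually (Units.isOpen.mem_nhds (by simp [hT₀]))
  have hsum : ContDiffAt ℝ ∞ (fun t => ∑ i, c i (Ring.inverse (T t) x) * f i t) s :=
    ContDiffAt.sum fun i _ => (ContDiffAt.comp (g := c i) s (c i).contDiff.contDiffAt
      (hinv.clm_apply contDiffAt_const)).mul (hf i)
  refine hsum.congr_of_eventuallyEq ?_
  filter_upwards [hunit, hB] with t ht hBt
  have hx : T t (Ring.inverse (T t) x) = x := by
    rw [← mul_apply_eq_comp, Ring.mul_inverse_cancel _ ht]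
    rfl
  conv_lhs => rw [← hx]
  simp only [T, sum_apply, ContinuousLinearMap.smulRight_apply, map_sum, map_smul, smul_apply,
    hBt, smul_eq_mul]

/-- The alternating part of a bilinear form. -/
def altPart : (E →L[ℝ] E →L[ℝ] ℝ) →L[ℝ] E [⋀^Fin 2]→L[ℝ] ℝ :=
  (1 / 2 : ℝ) • (ContinuousAlternatingMap.alternatizeUncurryFinCLM ℝ E ℝ (n := 1)).comp
    (ContinuousLinearMap.compL ℝ E (E →L[ℝ] ℝ) (E [⋀^Fin 1]→L[ℝ] ℝ)
      (ContinuousAlternatingMap.ofSubsingletonLIE (0 : Fin 1) :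
        (E →L[ℝ] ℝ) ≃ₗᵢ[ℝ] (E [⋀^Fin 1]→L[ℝ] ℝ)).toLinearIsometry.toContinuousLinearMap)

omit [FiniteDimensional ℝ E] in
theorem altPart_apply (B : E →L[ℝ] E →L[ℝ] ℝ) (x y : E) :
    altPart B ![x, y] = (1 / 2) * (B x y - B y x) := by
  simp [altPart, ContinuousAlternatingMap.alternatizeUncurryFinCLM_apply,
    ContinuousAlternatingMap.alternatizeUncurryFin_apply, Fin.sum_univ_two, Fin.removeNth]
  ring


end Calculus

section Derivative

variable {E V : Type*} [NormedAddCommGroup E] [NormedSpace ℝ E]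
  [NormedAddCommGroup V] [NormedSpace ℝ V]

/-- Product rule applied to B(X, y) = α(D y) and to D X = Y. The derivative of X enters only as
B(X', y) = -β(D X'), and the second equation eliminates it. -/
theorem fderiv_form_apply {D : E → E →L[ℝ] V} {B : E → E →L[ℝ] E →L[ℝ] ℝ} {X : E → E} {Y : E → V}
    {s : E} (hD : DifferentiableAt ℝ D s) (hB : DifferentiableAt ℝ B s)
    (hX : DifferentiableAt ℝ X s) (hXY : ∀ᶠ t in 𝓝 s, D t (X t) = Y t) (α β : V →L[ℝ] ℝ) (y z : E)
    (hα : ∀ᶠ t in 𝓝 s, B t (X t) y = α (D t y)) (hβ : ∀ w, β (D s w) = -B s w y) :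
    fderiv ℝ B s z (X s) y =
      α (fderiv ℝ D s z y) + β (fderiv ℝ Y s z) - β (fderiv ℝ D s z (X s)) := by
  have h1 : fderiv ℝ Y s z = D s (fderiv ℝ X s z) + fderiv ℝ D s z (X s) := by
    have h : HasFDerivAt (fun t => D t (X t)) _ s := hD.hasFDerivAt.clm_apply hX.hasFDerivAt
    rw [← Filter.EventuallyEq.fderiv_eq hXY, h.fderiv]
    simp
  have h2 : B s (fderiv ℝ X s z) y + fderiv ℝ B s z (X s) y = α (fderiv ℝ D s z y) := by
    have hl : HasFDerivAt (fun t => B t (X t) y) _ s :=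
      (hB.hasFDerivAt.clm_apply hX.hasFDerivAt).clm_apply (hasFDerivAt_const y s)
    have hr : HasFDerivAt (fun t => α (D t y)) _ s :=
      α.hasFDerivAt.comp s (hD.hasFDerivAt.clm_apply (hasFDerivAt_const y s))
    have := congrArg (fun T : E →L[ℝ] ℝ => T z) (Filter.EventuallyEq.fderiv_eq hα)
    rw [hl.fderiv, hr.fderiv] at this
    simpa using this
  rw [h1, map_add, hβ, ← h2]
  ring

end Derivative

namespace BivectorField

variable {V : Type*} [NormedAddCommGroup V] [NormedSpace ℝ V] [FiniteDimensional ℝ V]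

/-- The Jacobi identity for linear functions. -/
theorem IsPoissonOn.jacobi_linear {π : BivectorField V} {W : Set V}
    (hπ : π.IsPoissonOn W) {m : V} (hm : m ∈ W) (α β γ : Module.Dual ℝ V) :
    fderiv ℝ (fun x => π x α β) m (π.sharp m γ) + fderiv ℝ (fun x => π x β γ) m (π.sharp m α) +
      fderiv ℝ (fun x => π x γ α) m (π.sharp m β) = 0 := by
  have hfd : ∀ (δ : Module.Dual ℝ V) (x : V),
      ((fderiv ℝ (fun y => δ y) x : V →L[ℝ] ℝ) : V →ₗ[ℝ] ℝ) = δ := fun δ x => by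
    have : (fun y => δ y) = (LinearMap.toContinuousLinearMap δ : V → ℝ) := rfl
    rw [this, ContinuousLinearMap.fderiv]
    rfl
  have hsm : ∀ δ : Module.Dual ℝ V, ContDiffOn ℝ ∞ (fun y => δ y) W := fun δ =>
    (LinearMap.toContinuousLinearMap δ).contDiff.contDiffOn
  have hbr : ∀ δ ε : Module.Dual ℝ V,
      π.bracket (fun y => δ y) (fun y => ε y) = fun x => π x δ ε := fun δ ε => by
    funext x
    unfold bracket
    rw [hfd, hfd]
  -- Skewness moves the differential of {δ, ε} into the second slot, where pairing with π^#ζ is a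
  -- directional derivative.
  have key : ∀ δ ε ζ : Module.Dual ℝ V,
      π.bracket (π.bracket (fun y => δ y) (fun y => ε y)) (fun y => ζ y) m =
        -fderiv ℝ (fun x => π x δ ε) m (π.sharp m ζ) := fun δ ε ζ => by
    rw [hbr, bracket, hfd, hπ.skew m hm, ← dual_sharp]
    rfl
  have := hπ.jacobi _ _ _ (hsm α) (hsm β) (hsm γ) m hm
  rw [key, key, key] at this
  linarith

set_option maxHeartbeats 1000000 in
/-- The symplectic form induced by a Poisson structure on its leaves is smooth and closed. -/
theorem exists_closed_form {π : BivectorField V} {W : Set V}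
    (hW : IsOpen W) (hπ : ∀ α β : Module.Dual ℝ V, ContDiffOn ℝ ∞ (fun m => π m α β) W)
    (hskew : ∀ m ∈ W, ∀ α β : Module.Dual ℝ V, π m α β = -π m β α)
    (hjac : ∀ m ∈ W, ∀ α β γ : Module.Dual ℝ V,
      fderiv ℝ (fun x => π x α β) m (π.sharp m γ) + fderiv ℝ (fun x => π x β γ) m (π.sharp m α) +
        fderiv ℝ (fun x => π x γ α) m (π.sharp m β) = 0)
    {k : ℕ} {S : Set (EuclideanSpace ℝ (Fin k))} {φ : EuclideanSpace ℝ (Fin k) → V}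
    (hφ : IsLeafChart π.dist W S φ) :
    ∃ η : EuclideanSpace ℝ (Fin k) → EuclideanSpace ℝ (Fin k) [⋀^Fin 2]→L[ℝ] ℝ,
      (∀ s ∈ S, ∀ (x y : EuclideanSpace ℝ (Fin k)) (α : Module.Dual ℝ V),
        π.sharp (φ s) α = fderiv ℝ φ s x → η s ![x, y] = α (fderiv ℝ φ s y)) ∧
      ContDiffOn ℝ ∞ η S ∧ ∀ s ∈ S, extDeriv η s = 0 := by
  -- The value off S is irrelevant: S is open and only germs at its points matter.
  have hB : ∀ s, ∃ B : EuclideanSpace ℝ (Fin k) →L[ℝ] EuclideanSpace ℝ (Fin k) →L[ℝ] ℝ,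
      s ∈ S → ∀ x y α, π.sharp (φ s) α = fderiv ℝ φ s x → B x y = α (fderiv ℝ φ s y) := by
    intro s
    by_cases hs : s ∈ S
    · obtain ⟨B, hB⟩ := exists_pullback_form (hskew _ (hφ.mapsTo hs)) _ (hφ.range_eq s hs)
      exact ⟨B, fun _ => hB⟩
    · exact ⟨0, fun h => absurd h hs⟩
  choose B hB using hB
  have hSn : ∀ s ∈ S, S ∈ 𝓝 s := fun s hs => hφ.isOpen.mem_nhds hs
  have hex : ∀ s ∈ S, ∀ x, ∃ α, π.sharp (φ s) α = fderiv ℝ φ s x := fun s hs x => by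
    have : fderiv ℝ φ s x ∈ π.dist (φ s) := by
      rw [← hφ.range_eq s hs]
      exact LinearMap.mem_range_self (fderiv ℝ φ s : _ →ₗ[ℝ] V) x
    exact this
  have hDsm : ContDiffOn ℝ ∞ (fderiv ℝ φ) S :=
    hφ.smooth.fderiv_of_isOpen hφ.isOpen (by simp)
  have hYsm : ∀ α, ContDiffOn ℝ ∞ (fun s => π.sharp (φ s) α) S := fun α =>
    contDiffOn_of_dual fun β => by
      simp only [dual_sharp]
      exact (hπ α β).comp hφ.smooth hφ.mapsTo
  have hlift : ∀ s ∈ S, ∀ α, ∃ X : EuclideanSpace ℝ (Fin k) → EuclideanSpace ℝ (Fin k),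
      ContDiffAt ℝ ∞ X s ∧ ∀ᶠ t in 𝓝 s, fderiv ℝ φ t (X t) = π.sharp (φ t) α := fun s hs α => by
    refine exists_smooth_lift (hDsm.contDiffAt (hSn s hs)) (hφ.immersion s hs)
      ((hYsm α).contDiffAt (hSn s hs)) ?_
    filter_upwards [hSn s hs] with t ht
    have : π.sharp (φ t) α ∈ π.dist (φ t) := LinearMap.mem_range_self _ _
    rw [← hφ.range_eq t ht] at this
    exact this
  have hBX : ∀ s ∈ S, ∀ (α : Module.Dual ℝ V)
      (X : EuclideanSpace ℝ (Fin k) → EuclideanSpace ℝ (Fin k)), (∀ᶠ t in 𝓝 s, fderiv ℝ φ t (X t) = π.sharp (φ t) α) →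
      ∀ᶠ t in 𝓝 s, ∀ y, B t (X t) y = α (fderiv ℝ φ t y) := fun s hs α X hX => by
    filter_upwards [hX, hSn s hs] with t ht hts y
    exact hB t hts _ _ _ ht.symm
  have hBskew : ∀ s ∈ S, ∀ x y, B s x y = -B s y x := fun s hs x y => by
    obtain ⟨α, hα⟩ := hex s hs x
    obtain ⟨β, hβ⟩ := hex s hs y
    rw [hB s hs x y α hα, hB s hs y x β hβ, ← hα, ← hβ, dual_sharp, dual_sharp]
    exact hskew _ (hφ.mapsTo hs) β α
  have hBsm : ContDiffOn ℝ ∞ B S := by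
    rw [contDiffOn_clm_apply]
    intro x
    rw [contDiffOn_clm_apply]
    intro y s hs
    refine ContDiffAt.contDiffWithinAt ?_
    -- Covectors a i represent the basis at s. The lifts X i of π^#(a i) form a smooth local frame,
    -- on which B(X i, y) = a i (dφ y) is visibly smooth.
    choose a ha using fun i => hex s hs (Module.finBasis ℝ (EuclideanSpace ℝ (Fin k)) i)
    choose X hXsm hX using fun i => hlift s hs (a i)
    refine contDiffAt_form (Module.finBasis ℝ (EuclideanSpace ℝ (Fin k))) hXsm
      (fun i => hφ.immersion s hs ((hX i).self_of_nhds.trans (ha i)))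
      (f := fun i t => LinearMap.toContinuousLinearMap (a i) (fderiv ℝ φ t y))
      (fun i => ContDiffAt.comp s (LinearMap.toContinuousLinearMap (a i)).contDiff.contDiffAt
        ((hDsm.contDiffAt (hSn s hs)).clm_apply contDiffAt_const)) x y ?_
    exact Filter.eventually_all.2 fun i => (hBX s hs (a i) (X i) (hX i)).mono fun t ht => ht y
  have hηB : ∀ s ∈ S, ∀ x y, altPart (B s) ![x, y] = B s x y := fun s hs x y => by
    rw [altPart_apply, hBskew s hs y x]
    ring
  have hηsm : ContDiffOn ℝ ∞ (fun s => altPart (B s)) S :=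
    contDiffOn_const.clm_apply hBsm
  refine ⟨fun s => altPart (B s), fun s hs x y α h => (hηB s hs x y).trans (hB s hs x y α h),
    hηsm, fun s hs => ?_⟩
  have hBd : DifferentiableAt ℝ B s := (hBsm.contDiffAt (hSn s hs)).differentiableAt (by simp)
  have hDd : DifferentiableAt ℝ (fderiv ℝ φ) s :=
    (hDsm.contDiffAt (hSn s hs)).differentiableAt (by simp)
  have hηd : DifferentiableAt ℝ (fun s => altPart (B s)) s :=
    (hηsm.contDiffAt (hSn s hs)).differentiableAt (by simp)
  have hη' : ∀ x y z, fderiv ℝ (fun t => altPart (B t) ![x, y]) s z = fderiv ℝ B s z x y := by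
    intro x y z
    have h : (fun t => altPart (B t) ![x, y]) =ᶠ[𝓝 s] fun t => B t x y := by
      filter_upwards [hSn s hs] with t ht using hηB t ht x y
    have h' : HasFDerivAt (fun t => B t x y) _ s :=
      (hBd.hasFDerivAt.clm_apply (hasFDerivAt_const x s)).clm_apply (hasFDerivAt_const y s)
    rw [h.fderiv_eq, h'.fderiv]
    simp
  have hB'skew : ∀ x y z, fderiv ℝ B s z x y = -fderiv ℝ B s z y x := by
    intro x y z
    rw [← hη', ← hη', ← neg_apply, ← fderiv_fun_neg]
    congr 2
    funext t
    rw [altPart_apply, altPart_apply]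
    ring
  -- The derivative of B along the flat directions: a derivative of the Poisson coefficient π(α, β),
  -- corrected by second derivatives of φ.
  have hform : ∀ x y z α β γ, π.sharp (φ s) α = fderiv ℝ φ s x →
      π.sharp (φ s) β = fderiv ℝ φ s y → π.sharp (φ s) γ = fderiv ℝ φ s z →
      fderiv ℝ B s z x y = α (fderiv ℝ (fderiv ℝ φ) s z y) +
        fderiv ℝ (fun m => π m α β) (φ s) (π.sharp (φ s) γ) -
        β (fderiv ℝ (fderiv ℝ φ) s z x) := by
    intro x y z α β γ hα hβ hγ
    obtain ⟨X, hXsm, hX⟩ := hlift s hs α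
    have hXs : X s = x := hφ.immersion s hs (hX.self_of_nhds.trans hα)
    have h := fderiv_form_apply hDd hBd (hXsm.differentiableAt (by simp)) hX
      (LinearMap.toContinuousLinearMap α) (LinearMap.toContinuousLinearMap β) y z
      ((hBX s hs α X hX).mono fun t ht => ht y)
      (fun w => ((hB s hs y w β hβ).symm.trans (hBskew s hs y w)))
    rw [hXs] at h
    rw [h]
    have h3 : fderiv ℝ (fun m => π m α β) (φ s) (π.sharp (φ s) γ) =
        β (fderiv ℝ (fun t => π.sharp (φ t) α) s z) := by
      have e1 : HasFDerivAt (fun t => LinearMap.toContinuousLinearMap β (π.sharp (φ t) α)) _ s :=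
        (LinearMap.toContinuousLinearMap β).hasFDerivAt.comp s
          (((hYsm α).contDiffAt (hSn s hs)).differentiableAt (by simp)).hasFDerivAt
      have e2 : HasFDerivAt (fun t => π (φ t) α β) _ s :=
        HasFDerivAt.comp (g := fun m => π m α β) s
          ((((hπ α β).contDiffAt (hW.mem_nhds (hφ.mapsTo hs))).differentiableAt
            (by simp)).hasFDerivAt)
          ((hφ.smooth.contDiffAt (hSn s hs)).differentiableAt (by simp)).hasFDerivAt
      have e3 : (fun t => LinearMap.toContinuousLinearMap β (π.sharp (φ t) α)) =
          fun t => π (φ t) α β := by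
        funext t
        exact dual_sharp π (φ t) α β
      rw [e3] at e1
      have e4 := congrArg (fun T : EuclideanSpace ℝ (Fin k) →L[ℝ] ℝ => T z) (e1.unique e2)
      rw [hγ]
      exact e4.symm
    rw [h3]
    rfl
  ext v
  obtain ⟨x, y, z, rfl⟩ : ∃ x y z, v = ![x, y, z] :=
    ⟨v 0, v 1, v 2, by ext i : 1; fin_cases i <;> rfl⟩
  have r0 : (0 : Fin 3).removeNth ![x, y, z] = ![y, z] := by
    ext i : 1; fin_cases i <;> rfl
  have r1 : (1 : Fin 3).removeNth ![x, y, z] = ![x, z] := by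
    ext i : 1; fin_cases i <;> rfl
  have r2 : (2 : Fin 3).removeNth ![x, y, z] = ![x, y] := by
    ext i : 1; fin_cases i <;> rfl
  rw [extDeriv_apply hηd, Fin.sum_univ_three, r0, r1, r2, hη', hη', hη']
  obtain ⟨α, hα⟩ := hex s hs x
  obtain ⟨β, hβ⟩ := hex s hs y
  obtain ⟨γ, hγ⟩ := hex s hs z
  -- In the alternating sum of the three formulas the second derivatives of φ cancel by symmetry,
  -- and what remains is the Jacobi identity for α, β, γ.
  have hsymm := ((hφ.smooth.contDiffAt (hSn s hs)).isSymmSndFDerivAt (by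
    rw [minSmoothness_of_isRCLikeNormedField]
    exact WithTop.coe_le_coe.2 (le_top : (2 : ℕ∞) ≤ ⊤)))
  have j := hjac _ (hφ.mapsTo hs) α β γ
  have q1 := hform x y z α β γ hα hβ hγ
  have q2 := hform y z x β γ α hβ hγ hα
  have q3 := hform z x y γ α β hγ hα hβ
  have q4 := hB'skew x z y
  rw [hsymm.eq z y] at q1
  rw [hsymm.eq x z] at q2
  rw [hsymm.eq y x] at q3
  simp
  linarith

end BivectorField
end

noncomputable section

/-! ### Frames of `su(2)` -/

section SU2Basis

theorem su2Inner_comm (x y : su2) : su2Inner x y = su2Inner y x := by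
  simp [su2Inner, LieModule.traceForm_comm ℝ su2 su2 x y]

theorem su2_mem_iff (X : Matrix (Fin 2) (Fin 2) ℂ) :
    X ∈ su2 ↔ X.conjTranspose = -X ∧ X.trace = 0 := Iff.rfl

/-- The coordinates on `su(2)` with respect to `i σ₃`, `i σ₂`, `i σ₁`. -/
def su2Coord : su2 ≃ₗ[ℝ] (Fin 3 → ℝ) where
  toFun X := ![(X.1 0 0).im, (X.1 0 1).re, (X.1 0 1).im]
  map_add' X Y := by ext i; fin_cases i <;> simp
  map_smul' c X := by ext i; fin_cases i <;> simp
  invFun v := ⟨!![⟨0, v 0⟩, ⟨v 1, v 2⟩; ⟨-v 1, v 2⟩, ⟨0, -v 0⟩], by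
    rw [su2_mem_iff]
    constructor
    · ext i j; fin_cases i <;> fin_cases j <;> simp [Complex.ext_iff]
    · simp [Matrix.trace_fin_two, Complex.ext_iff]⟩
  left_inv X := by
    obtain ⟨X, hX⟩ := X
    rw [su2_mem_iff] at hX
    have h := fun i j => congrFun (congrFun hX.1 i) j
    have h00 := h 0 0
    have h01 := h 0 1
    have h10 := h 1 0
    have ht := hX.2
    simp [Complex.ext_iff, Matrix.trace_fin_two] at h00 h01 h10 ht
    ext i j
    fin_cases i <;> fin_cases j <;> simp [Complex.ext_iff] <;> grind
  right_inv v := by ext i; fin_cases i <;> simp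

/-- The basis `i σ₃`, `i σ₂`, `i σ₁` of `su(2)`. -/
def su2Basis : Module.Basis (Fin 3) ℝ su2 := Module.Basis.ofEquivFun su2Coord

/-- The order σ₃, σ₂, σ₁ gives the positive sign: [iσ₃, iσ₂] = 2iσ₁. -/
theorem su2Coord_lie (X Y : su2) : su2Coord ⁅X, Y⁆ =
    (2 : ℝ) • crossProduct (su2Coord X) (su2Coord Y) := by
  obtain ⟨v, rfl⟩ := su2Coord.symm.surjective X
  obtain ⟨w, rfl⟩ := su2Coord.symm.surjective Y
  rw [LinearEquiv.apply_symm_apply, LinearEquiv.apply_symm_apply, cross_apply]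
  have h : ∀ X Y : su2, (⁅X, Y⁆ : su2).1 = X.1 * Y.1 - Y.1 * X.1 := fun _ _ => rfl
  ext i
  fin_cases i <;> simp [su2Coord, h] <;> ring

/-- In these coordinates ad X is 2X×, and the trace of (X×)(Y×) is -2 X·Y; hence the factor 4 · 2 =
8. -/
theorem su2Inner_eq (X Y : su2) :
    su2Inner X Y = 8 * ∑ i, su2Coord X i * su2Coord Y i := by
  have h : su2Inner X Y = -∑ i, su2Coord ⁅X, ⁅Y, su2Basis i⁆⁆ i := by
    simp only [su2Inner, LinearMap.neg_apply, killingForm_apply_apply,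
      LinearMap.trace_eq_matrix_trace ℝ su2Basis, Matrix.trace, Matrix.diag_apply,
      LinearMap.toMatrix_apply]
    rfl
  have hb : ∀ i, su2Coord (su2Basis i) = Pi.single i 1 := fun i => by
    simp [su2Basis, Module.Basis.ofEquivFun]
  rw [h]
  simp only [su2Coord_lie, hb, cross_apply, Fin.sum_univ_three]
  simp
  ring

theorem finrank_su2 : Module.finrank ℝ su2 = 3 := by
  rw [su2Coord.finrank_eq]
  simp

end SU2Basis

namespace Frame

/-- The frame given by an orthonormal triple. -/
def ofOrthonormal (v : Fin 3 → su2) (h : ∀ i j, su2Inner (v i) (v j) = if i = j then 1 else 0) :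
    Frame where
  basis := basisOfLinearIndependentOfCardEqFinrank (b := v) (by
    rw [Fintype.linearIndependent_iff]
    intro c hc i
    have := congrArg (su2Inner (v i)) hc
    simpa [h] using this) (by simp [finrank_su2])
  orthonormal i j := by simp [h]

@[simp]
theorem ofOrthonormal_basis (v : Fin 3 → su2)
    (h : ∀ i j, su2Inner (v i) (v j) = if i = j then 1 else 0) (i : Fin 3) :
    (ofOrthonormal v h).basis i = v i := by
  simp [ofOrthonormal]

theorem repr_eq (F : Frame) (x : su2) (i : Fin 3) :
    F.basis.repr x i = su2Inner (F.basis i) x := by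
  conv_rhs => rw [← F.basis.sum_repr x, map_sum]
  simp only [map_smul, F.orthonormal]
  simp

theorem inner_eq (F : Frame) (x y : su2) :
    su2Inner x y = ∑ i, su2Inner x (F.basis i) * su2Inner y (F.basis i) := by
  conv_lhs => rw [← F.basis.sum_repr y]
  simp [repr_eq, su2Inner_comm y, mul_comm]

theorem sum_inner_smul (F : Frame) (x : su2) : ∑ i, su2Inner x (F.basis i) • F.basis i = x := by
  conv_rhs => rw [← F.basis.sum_repr x]
  simp only [repr_eq, su2Inner_comm x]

theorem det_eq (F : Frame) (v : Fin 3 → su2) :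
    F.basis.det v = (Matrix.of fun i j => su2Inner (F.basis i) (v j)).det := by
  rw [Module.Basis.det_apply]
  congr 1
  ext i j
  exact F.repr_eq _ _

theorem exists_orientation_eq (o : Orientation ℝ su2 (Fin 3)) :
    ∃ F : Frame, F.basis.orientation = o := by
  have h8 : √8 * √8 = (8 : ℝ) := Real.mul_self_sqrt (by norm_num)
  have h8' : √8 ≠ (0 : ℝ) := by positivity
  let F₀ := ofOrthonormal (fun i => (√8)⁻¹ • su2Basis i) fun i j => by
    have hb : ∀ i, su2Coord (su2Basis i) = Pi.single i 1 := fun i => by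
      simp [su2Basis, Module.Basis.ofEquivFun]
    rw [su2Inner_eq]
    simp only [map_smul, hb]
    fin_cases i <;> fin_cases j <;> simp [Fin.sum_univ_three]
    all_goals field_simp
    all_goals linarith
  by_cases h : F₀.basis.orientation = o
  · exact ⟨F₀, h⟩
  -- In odd dimension -1 reverses orientation, and there are only two orientations.
  let G := ofOrthonormal (fun i => -F₀.basis i) fun i j => by simp [F₀.orthonormal]
  refine ⟨G, ?_⟩
  have hG : G.basis.orientation ≠ F₀.basis.orientation := fun hG => by
    have := (Module.Basis.orientation_eq_iff_det_pos _ _).1 hG.symm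
    rw [det_eq, Matrix.det_fin_three] at this
    simp [G, F₀.orthonormal] at this
    linarith
  rw [(Module.Basis.orientation_ne_iff_eq_neg _ _).1 hG,
    (Module.Basis.orientation_ne_iff_eq_neg _ _).1 (Ne.symm h)]

theorem cycle_basis (F : Frame) (i j : Fin 3) : (F.cycle i).basis j = F.basis (j + i) := by
  simp [cycle]

theorem cycle_basis_zero (F : Frame) (i : Fin 3) : (F.cycle i).basis 0 = F.basis i := by
  rw [cycle_basis, zero_add]

/-- A cyclic permutation of three vectors is even. -/
theorem cycle_orientation (F : Frame) (i : Fin 3) :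
    (F.cycle i).basis.orientation = F.basis.orientation := by
  symm
  rw [Module.Basis.orientation_eq_iff_det_pos, det_eq, Matrix.det_fin_three]
  fin_cases i <;> simp [cycle_basis, F.orthonormal]

/-- The matrix of change of frame. -/
def changeMatrix (F T : Frame) : Matrix (Fin 3) (Fin 3) ℝ :=
  Matrix.of fun i j => su2Inner (F.basis i) (T.basis j)

variable {F T : Frame}

theorem changeMatrix_mul_transpose : changeMatrix F T * (changeMatrix F T).transpose = 1 := by
  ext i j
  rw [Matrix.mul_apply]
  simp only [changeMatrix, Matrix.transpose_apply, Matrix.of_apply]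
  rw [← T.inner_eq, F.orthonormal, Matrix.one_apply]

/-- Orthogonality gives det² = 1, equal orientation gives det > 0. -/
theorem det_changeMatrix (h : F.basis.orientation = T.basis.orientation) :
    (changeMatrix F T).det = 1 := by
  have h1 := congrArg Matrix.det (changeMatrix_mul_transpose (F := F) (T := T))
  rw [Matrix.det_mul, Matrix.det_transpose, Matrix.det_one] at h1
  have h2 := (Module.Basis.orientation_eq_iff_det_pos _ _).1 h
  rw [det_eq] at h2
  have h3 : 0 < (changeMatrix F T).det := h2
  nlinarith

theorem changeMatrix_mem (h : F.basis.orientation = T.basis.orientation) :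
    changeMatrix F T ∈ Matrix.specialOrthogonalGroup (Fin 3) ℝ := by
  rw [Matrix.mem_specialOrthogonalGroup_iff, Matrix.mem_orthogonalGroup_iff]
  exact ⟨changeMatrix_mul_transpose, det_changeMatrix h⟩

/-- Frames of the same orientation define the same volume form. -/
theorem basis_det_eq (h : F.basis.orientation = T.basis.orientation) :
    F.basis.det = T.basis.det := by
  rw [F.basis.det.eq_smul_basis_det T.basis, det_eq]
  have : (Matrix.of fun i j => su2Inner (F.basis i) (T.basis j)).det = 1 := det_changeMatrix h
  rw [this, one_smul]

end Frame

/-! ### Linear functions and bivector fields on `L(𝔤, su(2))` -/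

section Pairing

variable {g : Type*} [LieRing g] [LieAlgebra ℝ g]

/-- The value of an element of `L(𝔤, su(2))`. -/
def HomSU2.eval (ξ : g) : HomSU2 g →ₗ[ℝ] su2 :=
  (LinearMap.applyₗ ξ : (g →ₗ[ℝ] su2) →ₗ[ℝ] su2)

/-- The linear function `m ↦ ⟨x, m ξ⟩` on `L(𝔤, su(2))`. -/
def pairing (ξ : g) (x : su2) : Module.Dual ℝ (HomSU2 g) := su2Inner x ∘ₗ HomSU2.eval ξ

theorem pairing_apply (ξ : g) (x : su2) (m : HomSU2 g) :
    pairing ξ x m = su2Inner x (HomSU2.eval ξ m) := rfl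

/-- The inclusions of the factors of `𝔤 × 𝔤 × 𝔤`. -/
def Triple.single (i : Fin 3) : g →ₗ[ℝ] Triple g := LinearMap.single ℝ (fun _ : Fin 3 => g) i

theorem Triple.single_same (i : Fin 3) (x : g) : Triple.single i x i = x :=
  Pi.single_eq_same (M := fun _ : Fin 3 => g) i x

theorem Triple.single_of_ne {i j : Fin 3} (h : j ≠ i) (x : g) : Triple.single i x j = 0 :=
  Pi.single_eq_of_ne (M := fun _ : Fin 3 => g) h x

theorem Triple.sum_single (p : Triple g) : ∑ i, Triple.single i (p i) = p :=
  Finset.univ_sum_single (M := fun _ : Fin 3 => g) p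

variable [FiniteDimensional ℝ g] [LieAlgebra.IsSemisimple ℝ g]

theorem killingDual_apply (x y : g) : killingDual x y = killingForm ℝ g x y := rfl

theorem killingForm_killingDual_symm (α : Module.Dual ℝ g) (y : g) :
    killingForm ℝ g (killingDual.symm α) y = α y := by
  rw [← killingDual_apply, LinearEquiv.apply_symm_apply]

omit [FiniteDimensional ℝ g] [LieAlgebra.IsSemisimple ℝ g] in
theorem killingForm_comm (x y : g) : killingForm ℝ g x y = killingForm ℝ g y x :=
  LieModule.traceForm_comm ℝ g g x y

omit [FiniteDimensional ℝ g] [LieAlgebra.IsSemisimple ℝ g] in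
theorem killingForm_lie (x y z : g) : killingForm ℝ g ⁅x, y⁆ z = killingForm ℝ g x ⁅y, z⁆ :=
  LieModule.traceForm_apply_lie_apply ℝ g g x y z

theorem eq_of_killingForm_eq {x y : g} (h : ∀ z, killingForm ℝ g x z = killingForm ℝ g y z) :
    x = y :=
  killingDual.injective (LinearMap.ext h)

theorem killingForm_contract (B : LinearMap.BilinForm ℝ g) (u v : g) :
    killingForm ℝ g (contract B u) v = B u v :=
  killingForm_killingDual_symm _ _

namespace Frame

variable (F T : Frame)

theorem identify_apply (m : HomSU2 g) (i : Fin 3) (ξ : g) :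
    killingForm ℝ g (F.identify m i) ξ = su2Inner (F.basis i) (HomSU2.eval ξ m) := by
  refine (killingForm_killingDual_symm _ _).trans ?_
  exact F.repr_eq _ _

theorem eval_identify_symm (p : Triple g) (ξ : g) :
    HomSU2.eval ξ (F.identify.symm p) = ∑ i, killingForm ℝ g (p i) ξ • F.basis i :=
  LinearMap.sum_apply (Finset.univ : Finset (Fin 3))
    (fun i => (killingDual (p i)).smulRight (F.basis i)) ξ

theorem covectorComponent_pairing (ξ : g) (x : su2) (i : Fin 3) :
    covectorComponent i (F.identify.symm.dualMap (pairing ξ x)) =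
      su2Inner x (F.basis i) • ξ := by
  refine eq_of_killingForm_eq fun z => ?_
  refine (killingForm_killingDual_symm _ _).trans ?_
  change su2Inner x (HomSU2.eval ξ (F.identify.symm (Triple.single i z))) = _
  rw [eval_identify_symm, map_sum, Finset.sum_eq_single i]
  · rw [Triple.single_same]
    simp [killingForm_comm z ξ, mul_comm]
  · intro j _ hj
    rw [Triple.single_of_ne hj]
    simp
  · simp

/-- The frame-free form of the bracket table. The right-hand side sees the frame only through its
first vector, its volume form and the value of A, and it is linear in the first vector. -/
theorem bivector_pairing (A : Triple g → LinearMap.BilinForm ℝ g) (m : HomSU2 g) (ξ η : g)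
    (x y : su2) : F.bivector A m (pairing ξ x) (pairing η y) =
      F.basis.det ![F.basis 0, x, y] * A (F.identify m) ξ η +
      su2Inner (F.basis 0) x * su2Inner y (HomSU2.eval ⁅ξ, η⁆ m) +
      su2Inner (F.basis 0) y * su2Inner x (HomSU2.eval ⁅ξ, η⁆ m) -
      su2Inner x y * su2Inner (F.basis 0) (HomSU2.eval ⁅ξ, η⁆ m) := by
  have hl : ∀ i, lieForm (F.identify m i) ξ η =
      su2Inner (F.basis i) (HomSU2.eval ⁅ξ, η⁆ m) := fun i => by
    rw [← identify_apply, killingForm_comm]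
    rfl
  have h1 : F.bivector A m (pairing ξ x) (pairing η y) = ∑ i, ∑ j,
      su2Inner x (F.basis i) * su2Inner y (F.basis j) *
        bracketTable A (F.identify m) i j ξ η := by
    change tripleBivector A (F.identify m) (F.identify.symm.dualMap (pairing ξ x))
      (F.identify.symm.dualMap (pairing η y)) = _
    simp only [tripleBivector, LinearMap.sum_apply, LinearMap.compl₁₂_apply,
      covectorComponent_pairing, map_smul, LinearMap.smul_apply, smul_eq_mul, mul_assoc]
    refine Finset.sum_congr rfl fun i _ => Finset.sum_congr rfl fun j _ => ?_
    ring
  rw [h1, F.det_eq, Matrix.det_fin_three, F.inner_eq x y, F.inner_eq x (HomSU2.eval _ m),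
    F.inner_eq y (HomSU2.eval _ m)]
  simp only [Fin.sum_univ_three, bracketTable, Matrix.of_apply, Matrix.cons_val', Matrix.cons_val,
    LinearMap.neg_apply, hl, F.orthonormal, su2Inner_comm (HomSU2.eval _ m),
    su2Inner_comm x, su2Inner_comm y]
  simp
  ring

variable {F T}

/-- A change of frame acts on triples by its matrix, so the SO(3)-invariance of U and A makes both
independent of the oriented frame. -/
theorem identify_act (m : HomSU2 g) :
    T.identify m = (F.identify m).act (changeMatrix F T) := by
  funext j
  refine eq_of_killingForm_eq fun z => ?_
  rw [identify_apply, F.inner_eq]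
  simp only [Triple.act, changeMatrix, Matrix.of_apply, map_sum, map_smul, LinearMap.sum_apply,
    LinearMap.smul_apply, identify_apply, smul_eq_mul, su2Inner_comm (F.basis _)]

variable {U : Set (Triple g)} {A : Triple g → LinearMap.BilinForm ℝ g}

theorem domain_eq (hUinv : ∀ O ∈ Matrix.specialOrthogonalGroup (Fin 3) ℝ, ∀ p ∈ U, p.act O ∈ U)
    (h : F.basis.orientation = T.basis.orientation) : F.domain U = T.domain U := by
  ext m
  constructor
  · intro hm
    have := hUinv _ (changeMatrix_mem h) _ hm
    rwa [← identify_act] at this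
  · intro hm
    have := hUinv _ (changeMatrix_mem h.symm) _ hm
    rwa [← identify_act] at this

theorem tensor_eq
    (hAinv : ∀ O ∈ Matrix.specialOrthogonalGroup (Fin 3) ℝ, ∀ p ∈ U, A (p.act O) = A p)
    (h : F.basis.orientation = T.basis.orientation) {m : HomSU2 g} (hm : m ∈ F.domain U) :
    A (T.identify m) = A (F.identify m) := by
  rw [identify_act (F := F), hAinv _ (changeMatrix_mem h) _ hm]

theorem dual_eq_sum_pairing (F : Frame) (α : Module.Dual ℝ (HomSU2 g)) :
    α = ∑ i, pairing (covectorComponent i (F.identify.symm.dualMap α)) (F.basis i) := by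
  refine LinearMap.ext fun m => ?_
  obtain ⟨p, rfl⟩ := F.identify.symm.surjective m
  rw [LinearMap.sum_apply]
  have h : ∀ i, pairing (covectorComponent i (F.identify.symm.dualMap α)) (F.basis i)
      (F.identify.symm p) = α (F.identify.symm (Triple.single i (p i))) := fun i => by
    rw [pairing_apply, ← identify_apply, LinearEquiv.apply_symm_apply, killingForm_comm]
    exact killingForm_killingDual_symm _ _
  simp only [h]
  rw [← map_sum, ← map_sum, Triple.sum_single]

/-- The linear family of bundle maps `T^*M → TM`, with value `π_T^#` at the first
vector of a frame `T` of the orientation of `F`. -/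
def sharpFamily (F : Frame) (A : Triple g → LinearMap.BilinForm ℝ g) (m : HomSU2 g) :
    su2 →ₗ[ℝ] Module.Dual ℝ (HomSU2 g) →ₗ[ℝ] HomSU2 g :=
  ∑ i, (su2Inner (F.basis i)).smulRight (((F.cycle i).bivector A).sharp m)

theorem sharpFamily_apply (F : Frame) (A : Triple g → LinearMap.BilinForm ℝ g) (m : HomSU2 g)
    (x : su2) : F.sharpFamily A m x =
      ∑ i, su2Inner (F.basis i) x • ((F.cycle i).bivector A).sharp m := by
  simp [sharpFamily]

/-- `bivector_pairing` extended linearly from the first vectors of the cyclic frames, which are the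
vectors of F, to an arbitrary z. -/
theorem pairing_sharpFamily
    (hAinv : ∀ O ∈ Matrix.specialOrthogonalGroup (Fin 3) ℝ, ∀ p ∈ U, A (p.act O) = A p)
    {m : HomSU2 g} (hm : m ∈ F.domain U) (ξ η : g) (x y z : su2) :
    pairing η y (F.sharpFamily A m z (pairing ξ x)) =
      F.basis.det ![z, x, y] * A (F.identify m) ξ η +
      su2Inner z x * su2Inner y (HomSU2.eval ⁅ξ, η⁆ m) +
      su2Inner z y * su2Inner x (HomSU2.eval ⁅ξ, η⁆ m) -
      su2Inner x y * su2Inner z (HomSU2.eval ⁅ξ, η⁆ m) := by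
  have hd : F.basis.det ![z, x, y] =
      ∑ i, su2Inner (F.basis i) z * F.basis.det ![F.basis i, x, y] := by
    conv_lhs => rw [← F.sum_inner_smul z]
    simp only [F.det_eq, Matrix.det_fin_three, Fin.sum_univ_three, Matrix.of_apply,
      Matrix.cons_val, map_add, map_smul, F.orthonormal, smul_eq_mul]
    simp [su2Inner_comm z]
    ring
  rw [sharpFamily_apply, LinearMap.sum_apply, map_sum, hd]
  have hs : ∀ w, su2Inner z w = ∑ i, su2Inner (F.basis i) z * su2Inner (F.basis i) w := fun w => by
    rw [F.inner_eq]
    simp only [su2Inner_comm (F.basis _)]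
  simp only [LinearMap.smul_apply, map_smul, BivectorField.dual_sharp, bivector_pairing,
    cycle_basis_zero, basis_det_eq (cycle_orientation F _), smul_eq_mul, hs,
    tensor_eq hAinv (cycle_orientation F _).symm hm]
  simp only [Fin.sum_univ_three]
  ring

/-- `π_T^#` depends only on the first vector of `T`, and linearly so. -/
theorem sharp_eq_sharpFamily
    (hAinv : ∀ O ∈ Matrix.specialOrthogonalGroup (Fin 3) ℝ, ∀ p ∈ U, A (p.act O) = A p)
    (h : F.basis.orientation = T.basis.orientation) {m : HomSU2 g} (hm : m ∈ F.domain U) :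
    (T.bivector A).sharp m = F.sharpFamily A m (T.basis 0) := by
  refine LinearMap.ext fun α => ?_
  have hsep : ∀ v w : HomSU2 g, (∀ β : Module.Dual ℝ (HomSU2 g), β v = β w) → v = w :=
    fun v w hvw => sub_eq_zero.1 ((Module.forall_dual_apply_eq_zero_iff ℝ _).1 fun β => by
      rw [map_sub, hvw, sub_self])
  refine hsep _ _ fun β => ?_
  rw [F.dual_eq_sum_pairing α, F.dual_eq_sum_pairing β]
  simp only [map_sum, LinearMap.sum_apply, pairing_sharpFamily hAinv hm, BivectorField.dual_sharp,
    bivector_pairing, tensor_eq hAinv h hm, basis_det_eq h]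

end Frame

end Pairing
end

noncomputable section

/-! ### Quaternionic description of the linear system -/

section Quaternion

variable {g : Type*} [LieRing g] [LieAlgebra ℝ g]

/-- Left multiplication by `B + i a + j b + k c` on `ℍ ⊗ 𝔤`, where `a, b, c` act by brackets. -/
def quatLeft (B : g →ₗ[ℝ] g) (p : Fin 3 → g) : (Fin 4 → g) →ₗ[ℝ] Fin 4 → g where
  toFun x := ![B (x 0) - ⁅p 0, x 1⁆ - ⁅p 1, x 2⁆ - ⁅p 2, x 3⁆,
    B (x 1) + ⁅p 0, x 0⁆ + ⁅p 1, x 3⁆ - ⁅p 2, x 2⁆,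
    B (x 2) + ⁅p 1, x 0⁆ + ⁅p 2, x 1⁆ - ⁅p 0, x 3⁆,
    B (x 3) + ⁅p 2, x 0⁆ + ⁅p 0, x 2⁆ - ⁅p 1, x 1⁆]
  map_add' x y := by ext i; fin_cases i <;> simp <;> abel
  map_smul' c x := by ext i; fin_cases i <;> simp [smul_add, smul_sub]

/-- Right multiplication by the imaginary quaternion `e` on `ℍ ⊗ 𝔤`. -/
def quatRight (e : Fin 3 → ℝ) : (Fin 4 → g) →ₗ[ℝ] Fin 4 → g where
  toFun x := ![-(e 0 • x 1) - e 1 • x 2 - e 2 • x 3,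
    e 0 • x 0 - e 1 • x 3 + e 2 • x 2,
    e 0 • x 3 + e 1 • x 0 - e 2 • x 1,
    -(e 0 • x 2) + e 1 • x 1 + e 2 • x 0]
  map_add' x y := by ext i; fin_cases i <;> simp <;> module
  map_smul' c x := by ext i; fin_cases i <;> simp <;> module

/-- The inclusion of the imaginary part of `ℍ ⊗ 𝔤`. -/
def quatImag : (Fin 3 → g) →ₗ[ℝ] Fin 4 → g where
  toFun ξ := ![0, ξ 0, ξ 1, ξ 2]
  map_add' x y := by ext i; fin_cases i <;> simp
  map_smul' c x := by ext i; fin_cases i <;> simp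

variable {B : g →ₗ[ℝ] g} {p : Fin 3 → g}

/-- Associativity of ℍ. -/
theorem quatLeft_quatRight (e : Fin 3 → ℝ) (x : Fin 4 → g) :
    quatLeft B p (quatRight e x) = quatRight e (quatLeft B p x) := by
  ext i
  fin_cases i <;> simp [quatLeft, quatRight] <;> module

theorem quatRight_quatRight (e : Fin 3 → ℝ) (x : Fin 4 → g) :
    quatRight e (quatRight e x) = -((∑ i, e i * e i) • x) := by
  ext i
  fin_cases i <;> simp [quatRight, Fin.sum_univ_three] <;> module

theorem quatRight_eq_sum (e : Fin 3 → ℝ) (x : Fin 4 → g) :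
    quatRight e x = ∑ i, e i • quatRight (Pi.single i 1) x := by
  ext i
  fin_cases i <;> simp [quatRight, Fin.sum_univ_three] <;> module

/-- The fourth equation is the real component, the first three are the i, j, k components. -/
theorem solvesSystem_iff [FiniteDimensional ℝ g] [LieAlgebra.IsSemisimple ℝ g]
    (C : LinearMap.BilinForm ℝ g) (p : Fin 3 → g) (ξ u v w : g) :
    SolvesSystem C (p 0) (p 1) (p 2) ξ u v w ↔
      quatLeft (killingDual.symm.toLinearMap ∘ₗ C) p ![ξ, u, v, w] = 0 := by
  have hC : ∀ x, (killingDual.symm.toLinearMap ∘ₗ C) x = contract C x := fun _ => rfl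
  simp only [SolvesSystem, funext_iff, Fin.forall_fin_succ, quatLeft, LinearMap.coe_mk,
    AddHom.coe_mk, hC]
  simp only [Matrix.cons_val_zero, Matrix.cons_val, Matrix.cons_val_succ, Pi.zero_apply]
  rw [← lie_skew (p 0) u, ← lie_skew (p 0) v, ← lie_skew (p 0) w, ← lie_skew (p 0) ξ,
    ← lie_skew (p 1) u, ← lie_skew (p 1) v, ← lie_skew (p 1) w, ← lie_skew (p 1) ξ,
    ← lie_skew (p 2) u, ← lie_skew (p 2) v, ← lie_skew (p 2) w, ← lie_skew (p 2) ξ]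
  simp only [IsEmpty.forall_iff, and_true]
  grind

/-- Left multiplication by i, j, k and the operators ad a are both skew, so their products are
symmetric. -/
theorem killingForm_quatLeft [FiniteDimensional ℝ g] (hB : ∀ x y, killingForm ℝ g (B x) y =
    killingForm ℝ g x (B y)) (x y : Fin 4 → g) :
    ∑ i, killingForm ℝ g (quatLeft B p x i) (y i) =
      ∑ i, killingForm ℝ g (x i) (quatLeft B p y i) := by
  have h : ∀ a x y : g, killingForm ℝ g ⁅a, x⁆ y = -killingForm ℝ g x ⁅a, y⁆ := fun a x y => by
    rw [← lie_skew, map_neg, LinearMap.neg_apply, killingForm_lie]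
  simp only [Fin.sum_univ_four, quatLeft, LinearMap.coe_mk, AddHom.coe_mk]
  simp [h, hB]
  ring

/-- If the system is solvable, the range of `quatLeft` does not meet the real part. -/
theorem quatLeft_eq_zero [FiniteDimensional ℝ g] [LieAlgebra.IsSemisimple ℝ g]
    (hB : ∀ x y, killingForm ℝ g (B x) y = killingForm ℝ g x (B y))
    (hsys : ∀ ξ, ∃ z, quatLeft B p z = 0 ∧ z 0 = ξ) {x : Fin 4 → g}
    (hx : ∀ j : Fin 3, quatLeft B p x j.succ = 0) : quatLeft B p x = 0 := by
  have h0 : quatLeft B p x 0 = 0 := by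
    refine eq_of_killingForm_eq fun ξ => ?_
    obtain ⟨z, hz, rfl⟩ := hsys ξ
    -- For z ∈ ker Q: 0 = ⟨Qz, x⟩ = ⟨z, Qx⟩ = ⟨ξ, (Qx)₀⟩, because Qx is real.
    have h := killingForm_quatLeft (p := p) hB z x
    rw [hz, Fin.sum_univ_succ (n := 3) (fun i => killingForm ℝ g (z i) _)] at h
    simp only [hx] at h
    simp at h
    rw [killingForm_comm, ← h]
    simp
  funext i
  exact Fin.cases h0 hx i

end Quaternion

/-! ### The family of bundle maps in quaternionic terms -/

section Family

variable {g : Type*} [LieRing g] [LieAlgebra ℝ g] [FiniteDimensional ℝ g]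
  [LieAlgebra.IsSemisimple ℝ g]

namespace Frame

/-- The operator `A^# + i a + j b + k c` of a point `m = (a, b, c)`. -/
def quatOp (F : Frame) (A : Triple g → LinearMap.BilinForm ℝ g) (m : HomSU2 g) :
    (Fin 4 → g) →ₗ[ℝ] Fin 4 → g :=
  quatLeft (killingDual.symm.toLinearMap ∘ₗ A (F.identify m)) (F.identify m)

theorem quatOp_quatRight (F : Frame) (A : Triple g → LinearMap.BilinForm ℝ g) (m : HomSU2 g)
    (e : Fin 3 → ℝ) (x : Fin 4 → g) :
    F.quatOp A m (quatRight e x) = quatRight e (F.quatOp A m x) :=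
  quatLeft_quatRight e x

/-- The covector with given components. -/
def covector (F : Frame) : (Fin 3 → g) →ₗ[ℝ] Module.Dual ℝ (HomSU2 g) where
  toFun ξ := ∑ i, pairing (ξ i) (F.basis i)
  map_add' ξ η := by
    rw [← Finset.sum_add_distrib]
    refine Finset.sum_congr rfl fun i _ => LinearMap.ext fun m => ?_
    exact (congrArg (su2Inner (F.basis i)) ((show g →ₗ[ℝ] su2 from m).map_add (ξ i) (η i))).trans
      (map_add (su2Inner (F.basis i)) _ _)
  map_smul' c ξ := by
    rw [Finset.smul_sum]
    refine Finset.sum_congr rfl fun i _ => LinearMap.ext fun m => ?_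
    exact (congrArg (su2Inner (F.basis i)) ((show g →ₗ[ℝ] su2 from m).map_smul c (ξ i))).trans
      (map_smul (su2Inner (F.basis i)) _ _)

omit [FiniteDimensional ℝ g] [LieAlgebra.IsSemisimple ℝ g] in
theorem covector_apply (F : Frame) (ξ : Fin 3 → g) :
    F.covector ξ = ∑ i, pairing (ξ i) (F.basis i) := rfl

theorem exists_covector (F : Frame) (α : Module.Dual ℝ (HomSU2 g)) :
    ∃ ξ : Fin 3 → g, F.covector ξ = α :=
  ⟨fun i => covectorComponent i (F.identify.symm.dualMap α),
    (F.covector_apply _).trans (F.dual_eq_sum_pairing α).symm⟩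

variable {U : Set (Triple g)} {A : Triple g → LinearMap.BilinForm ℝ g} {F : Frame}
  {m : HomSU2 g}

/-- The bridge to quaternions: P_z ξ = -Im(Q(ξ)z), with z ∈ su(2) read as an imaginary quaternion
through its coordinates in F. -/
theorem identify_sharpFamily
    (hAinv : ∀ O ∈ Matrix.specialOrthogonalGroup (Fin 3) ℝ, ∀ p ∈ U, A (p.act O) = A p)
    (hm : m ∈ F.domain U) (z : su2) (ξ : Fin 3 → g) (j : Fin 3) :
    F.identify (F.sharpFamily A m z (F.covector ξ)) j =
      -quatRight (fun i => su2Inner z (F.basis i))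
        (F.quatOp A m
          (quatImag ξ)) j.succ := by
  refine eq_of_killingForm_eq fun η => ?_
  rw [← quatOp_quatRight, identify_apply, ← pairing_apply, covector_apply, map_sum, map_sum]
  simp only [pairing_sharpFamily hAinv hm]
  have hl : ∀ k x, su2Inner (F.basis k) (HomSU2.eval ⁅x, η⁆ m) =
      killingForm ℝ g ⁅F.identify m k, x⁆ η := fun k x => by
    rw [← identify_apply, killingForm_lie]
  have hz : ∀ x, su2Inner z x = ∑ k, su2Inner z (F.basis k) * su2Inner (F.basis k) x :=
    fun x => by
      rw [F.inner_eq]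
      simp only [su2Inner_comm (F.basis _)]
  simp only [fun x => hz (HomSU2.eval ⁅x, η⁆ m), hl, F.det_eq, Matrix.det_fin_three,
    Fin.sum_univ_three, F.orthonormal, Matrix.of_apply, Matrix.cons_val, su2Inner_comm _ z]
  fin_cases j <;> simp [quatOp, quatLeft, quatRight, quatImag, killingForm_killingDual_symm] <;> ring

variable (hAinv : ∀ O ∈ Matrix.specialOrthogonalGroup (Fin 3) ℝ, ∀ p ∈ U, A (p.act O) = A p)
  (hm : m ∈ F.domain U)

include hAinv hm

theorem sharpFamily_eq_iff (z z' : su2) (ξ ξ' : Fin 3 → g) :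
    F.sharpFamily A m z (F.covector ξ) = F.sharpFamily A m z' (F.covector ξ') ↔ ∀ j : Fin 3,
      quatRight (fun i => su2Inner z (F.basis i))
        (F.quatOp A m
          (quatImag ξ)) j.succ =
      quatRight (fun i => su2Inner z' (F.basis i))
        (F.quatOp A m
          (quatImag ξ')) j.succ := by
  rw [← F.identify.injective.eq_iff]
  constructor
  · intro h j
    have := congrFun h j
    rwa [identify_sharpFamily hAinv hm, identify_sharpFamily hAinv hm, neg_inj] at this
  · intro h
    funext j
    rw [identify_sharpFamily hAinv hm, identify_sharpFamily hAinv hm, h]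

/-- The two relations together control both the imaginary and the real part of Q at one element ζ of
ℍ ⊗ 𝔤, and ζj is the solution. -/
theorem exists_solvesSystem
    (h : ∀ α, ∃ α', F.sharpFamily A m (F.basis 0) α = F.sharpFamily A m (F.basis 1) α' ∧
      F.sharpFamily A m (F.basis 1) α = -F.sharpFamily A m (F.basis 0) α') (ξ : g) :
    ∃ u v w, SolvesSystem (A (F.identify m)) (F.identify m 0) (F.identify m 1) (F.identify m 2)
      ξ u v w := by
  -- With x = -kξ one has x·i·j = ξ, so that ζj below has real part ξ.
  obtain ⟨α', h1, h2⟩ := h (F.covector ![0, 0, -ξ])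
  obtain ⟨ξ', rfl⟩ := F.exists_covector α'
  rw [sharpFamily_eq_iff hAinv hm] at h1
  have h2' := fun j => congrFun (congrArg F.identify h2) j
  rw [map_neg] at h2'
  have hneg : ∀ (q : Triple g) j, (-q) j = -q j := fun _ _ => rfl
  simp only [hneg, identify_sharpFamily hAinv hm] at h2'
  set Q := F.quatOp A m with hQ
  let x : Fin 4 → g := quatImag ![0, 0, -ξ]
  let x' : Fin 4 → g := quatImag ξ'
  have hb0 : (fun i => su2Inner (F.basis 0) (F.basis i)) = ![1, 0, 0] := by
    ext i; fin_cases i <;> simp [F.orthonormal]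
  have hb1 : (fun i => su2Inner (F.basis 1) (F.basis i)) = ![0, 1, 0] := by
    ext i; fin_cases i <;> simp [F.orthonormal]
  rw [hb0, hb1] at h1 h2'
  -- ζ = xi - x'j: the first relation says Im(Qζ) = 0. Since ik = -j and jk = i, also ζk = -(xj +
  -- x'i), to which the second relation applies.
  let ζ := quatRight ![1, 0, 0] x - quatRight ![0, 1, 0] x'
  have hζ : ∀ j : Fin 3, Q ζ j.succ = 0 := fun j => by
    rw [map_sub, hQ, quatOp_quatRight, quatOp_quatRight, Pi.sub_apply]
    exact sub_eq_zero.2 (h1 j)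
  have hζ' : quatRight ![0, 0, 1] ζ =
      -(quatRight ![0, 1, 0] x + quatRight ![1, 0, 0] x') := by
    ext i; fin_cases i <;> simp [ζ, quatRight] <;> abel
  have hζ2 : Q ζ 0 = 0 := by
    -- The k-component of (Qζ)k is the real part of Qζ.
    have h3 : quatRight ![0, 0, 1] (Q ζ) 3 = 0 := by
      rw [hQ, ← quatOp_quatRight, ← hQ, hζ', map_neg, map_add, hQ, quatOp_quatRight, quatOp_quatRight,
        Pi.neg_apply, Pi.add_apply]
      have := h2' 2
      rw [neg_neg] at this
      have h4 : -quatRight ![0, 1, 0] (Q x) 3 = quatRight ![1, 0, 0] (Q x') 3 := this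
      rw [← h4]
      abel
    simpa [quatRight] using h3
  have hζ0 : Q ζ = 0 := by
    funext i
    exact Fin.cases hζ2 hζ i
  refine ⟨quatRight ![0, 1, 0] ζ 1, quatRight ![0, 1, 0] ζ 2, quatRight ![0, 1, 0] ζ 3,
    (solvesSystem_iff _ (F.identify m) _ _ _ _).2 ?_⟩
  have he : ![ξ, quatRight ![0, 1, 0] ζ 1, quatRight ![0, 1, 0] ζ 2, quatRight ![0, 1, 0] ζ 3] =
      quatRight ![0, 1, 0] ζ := by
    funext i
    fin_cases i
    · simp [ζ, x, x', quatRight, quatImag]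
    · rfl
    · rfl
    · rfl
  rw [he]
  change F.quatOp A m _ = 0
  rw [quatOp_quatRight, ← hQ, hζ0, map_zero]

variable (hsymm : ∀ ξ η : g, A (F.identify m) ξ η = A (F.identify m) η ξ)
  (hsys : ∀ ξ : g, ∃ u v w : g, SolvesSystem (A (F.identify m)) (F.identify m 0)
    (F.identify m 1) (F.identify m 2) ξ u v w)

include hsymm hsys

omit hAinv hm in
theorem quatLeft_eq_of_imag_eq {x y : Fin 4 → g}
    (h : ∀ j : Fin 3,
      F.quatOp A m x j.succ =
      F.quatOp A m y j.succ) :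
    F.quatOp A m x =
      F.quatOp A m y := by
  rw [← sub_eq_zero, ← map_sub]
  refine quatLeft_eq_zero (fun x y => ?_) (fun ξ => ?_) fun j => ?_
  · rw [killingForm_comm x]
    exact (killingForm_contract _ _ _).trans
      ((hsymm x y).trans (killingForm_contract _ _ _).symm)
  · obtain ⟨u, v, w, h⟩ := hsys ξ
    exact ⟨_, (solvesSystem_iff _ (F.identify m) _ _ _ _).1 h, rfl⟩
  · rw [map_sub, Pi.sub_apply]
    exact sub_eq_zero.2 (h j)

omit hsymm hsys in
theorem sharpFamily_eq_of_quatLeft_eq {ξ ξ' : Fin 3 → g}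
    (h : F.quatOp A m
        (quatImag ξ) =
      F.quatOp A m
        (quatImag ξ')) (z : su2) :
    F.sharpFamily A m z (F.covector ξ) = F.sharpFamily A m z (F.covector ξ') := by
  rw [sharpFamily_eq_iff hAinv hm, h]
  exact fun _ => rfl

/-- The kernels of all maps of the family agree. -/
theorem sharpFamily_ker {z : su2} (hz : su2Inner z z = 1) {α : Module.Dual ℝ (HomSU2 g)}
    (h : F.sharpFamily A m z α = 0) (w : su2) : F.sharpFamily A m w α = 0 := by
  obtain ⟨ξ, rfl⟩ := F.exists_covector α
  have h1 : F.sharpFamily A m z (F.covector ξ) = F.sharpFamily A m z (F.covector 0) := by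
    rw [h, map_zero, map_zero]
  rw [sharpFamily_eq_iff hAinv hm] at h1
  simp only [← quatOp_quatRight] at h1
  have h2 := quatLeft_eq_of_imag_eq hsymm hsys h1
  simp only [map_zero, quatOp_quatRight] at h2
  -- Q(ξ)z = 0 gives Q(ξ) = 0, as z² = -1.
  have h3 := congrArg (quatRight fun i => su2Inner z (F.basis i)) h2
  rw [quatRight_quatRight, ← F.inner_eq, hz, one_smul, map_zero, neg_eq_zero] at h3
  rw [sharpFamily_eq_of_quatLeft_eq hAinv hm (ξ' := 0) (by rw [h3]; simp) w, map_zero, map_zero]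

/-- The inverses of the maps of the family depend linearly on the unit vector. -/
theorem sharpFamily_inverse_linear {z : su2} (hz : su2Inner z z = 1)
    {β : Module.Dual ℝ (HomSU2 g)} {α : Fin 3 → Module.Dual ℝ (HomSU2 g)}
    (h : ∀ i, F.sharpFamily A m z β = F.sharpFamily A m (F.basis i) (α i)) (w : su2) :
    F.sharpFamily A m w β = F.sharpFamily A m w (∑ i, su2Inner z (F.basis i) • α i) := by
  obtain ⟨η, rfl⟩ := F.exists_covector β
  choose ξ hξ using fun i => F.exists_covector (α i)
  have hcov : F.covector (∑ i, su2Inner z (F.basis i) • ξ i) =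
      ∑ i, su2Inner z (F.basis i) • α i := by
    simp only [map_sum, map_smul, hξ]
  have hb : ∀ k, (fun i => su2Inner (F.basis k) (F.basis i)) = Pi.single k 1 := fun k => by
    ext i
    simp [F.orthonormal, Pi.single_apply, eq_comm]
  have h1 : ∀ k, _ := fun k => by
    have h2 := h k
    rw [← hξ, sharpFamily_eq_iff hAinv hm] at h2
    simp only [← quatOp_quatRight] at h2
    have h3 := quatLeft_eq_of_imag_eq hsymm hsys h2
    rw [quatOp_quatRight, quatOp_quatRight, hb] at h3
    exact h3
  rw [← hcov]
  refine sharpFamily_eq_of_quatLeft_eq hAinv hm ?_ w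
  set Q := F.quatOp A m with hQ
  -- The common value y = Q(η)z = Q(ξ_k)e_k; multiplying by z or e_k on the right recovers Q(η) =
  -- -yz and Q(ξ_k) = -ye_k.
  set y := quatRight (fun i => su2Inner z (F.basis i)) (Q (quatImag η)) with hy
  have hη : Q (quatImag η) = -quatRight (fun i => su2Inner z (F.basis i)) y := by
    rw [hy, quatRight_quatRight, ← F.inner_eq, hz, one_smul, neg_neg]
  have hk : ∀ k, Q (quatImag (ξ k)) = -quatRight (Pi.single k 1) y := fun k => by
    rw [h1 k, quatRight_quatRight]
    simp [Pi.single_apply]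
  rw [map_sum, map_sum, hη, quatRight_eq_sum]
  simp [hk]

end Frame

end Family
end

noncomputable section

/-! ### Leaves -/

section LeafLemmas

variable {V : Type*} [NormedAddCommGroup V] [NormedSpace ℝ V] {D D' : V → Submodule ℝ V} {W : Set V}

theorem IsLeafChart.congr (h : ∀ m ∈ W, D m = D' m) {k : ℕ} {S : Set (EuclideanSpace ℝ (Fin k))}
    {φ : EuclideanSpace ℝ (Fin k) → V} (hφ : IsLeafChart D W S φ) : IsLeafChart D' W S φ :=
  { hφ with range_eq := fun s hs => (hφ.range_eq s hs).trans (h _ (hφ.mapsTo hs)) }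

theorem leaf_congr (h : ∀ m ∈ W, D m = D' m) (m : V) : leaf D W m = leaf D' W m := by
  have : InCommonChart D W = InCommonChart D' W := by
    funext x y
    exact propext ⟨fun ⟨k, S, φ, hφ, hx⟩ => ⟨k, S, φ, hφ.congr h, hx⟩,
      fun ⟨k, S, φ, hφ, hx⟩ => ⟨k, S, φ, hφ.congr fun m hm => (h m hm).symm, hx⟩⟩
  unfold leaf
  rw [this]

theorem leaf_subset {m : V} (hm : m ∈ W) : leaf D W m ⊆ W := by
  intro x hx
  induction hx with
  | refl => exact hm
  | tail _ h _ =>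
    obtain ⟨k, S, φ, hφ, -, s, hs, rfl⟩ := h
    exact hφ.mapsTo hs

end LeafLemmas

/-! ### Hypersymplectic structures from a linear family of bundle maps -/

section Pointwise

variable {V : Type*} [AddCommGroup V] [Module ℝ V] {P : su2 →ₗ[ℝ] Module.Dual ℝ V →ₗ[ℝ] V}

theorem apply_eq_of_mem_range
    (hskew : ∀ x (α β : Module.Dual ℝ V), β (P x α) = -α (P x β)) {z : su2}
    {α α' : Module.Dual ℝ V} (h : P z α = P z α') {v : V} (hv : v ∈ LinearMap.range (P z)) :
    α v = α' v := by
  obtain ⟨β, rfl⟩ := hv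
  rw [hskew z β α, hskew z β α', h]

theorem eq_of_apply_range_eq
    (hskew : ∀ x (α β : Module.Dual ℝ V), β (P x α) = -α (P x β)) {z : su2}
    {α α' : Module.Dual ℝ V} (h : ∀ v ∈ LinearMap.range (P z), α v = α' v) :
    P z α = P z α' := by
  rw [← sub_eq_zero, ← map_sub]
  refine (Module.forall_dual_apply_eq_zero_iff ℝ _).1 fun β => ?_
  rw [hskew, LinearMap.sub_apply, h _ (LinearMap.mem_range_self _ _), sub_self, neg_zero]

variable [FiniteDimensional ℝ V]

theorem range_eq_of_ker_eq
    (hskew : ∀ x (α β : Module.Dual ℝ V), β (P x α) = -α (P x β)) {z w : su2}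
    (h : ∀ α, P z α = 0 ↔ P w α = 0) : LinearMap.range (P z) = LinearMap.range (P w) := by
  -- The range of a skew map lies in the annihilator of its kernel and has the same dimension.
  have key : ∀ x, LinearMap.range (P x) = (LinearMap.ker (P x)).dualCoannihilator := fun x => by
    refine Submodule.eq_of_le_of_finrank_eq ?_ ?_
    · rintro _ ⟨α, rfl⟩
      rw [Submodule.mem_dualCoannihilator]
      intro β hβ
      rw [hskew, LinearMap.mem_ker.1 hβ, map_zero, neg_zero]
    · have h1 := LinearMap.finrank_range_add_finrank_ker (P x)
      have h2 := Subspace.finrank_add_finrank_dualCoannihilator_eq (LinearMap.ker (P x))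
      rw [Subspace.dual_finrank_eq] at h1
      omega
  have hk : LinearMap.ker (P z) = LinearMap.ker (P w) := by
    ext α
    exact h α
  rw [key, key, hk]

/-- Ω = ∑ ω_i e_i is built from sections τ_i of P_{e_i}. The hypothesis `hlin` shows that ω_z is
inverse to P_z for every unit z, so ω_z⁻¹ inherits linearity from P. -/
theorem exists_isHypersymplecticAt (F : Frame)
    (hskew : ∀ x (α β : Module.Dual ℝ V), β (P x α) = -α (P x β))
    (hker : ∀ z, su2Inner z z = 1 → ∀ α, P z α = 0 → ∀ w, P w α = 0)
    (hlin : ∀ z, su2Inner z z = 1 → ∀ (β : Module.Dual ℝ V) (α : Fin 3 → Module.Dual ℝ V),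
      (∀ i, P z β = P (F.basis i) (α i)) →
      ∀ w, P w β = P w (∑ i, su2Inner z (F.basis i) • α i))
    {D : Submodule ℝ V} (hD : D = LinearMap.range (P (F.basis 0))) :
    ∃ Ω : D →ₗ[ℝ] D →ₗ[ℝ] su2, IsHypersymplecticAt Ω ∧ ∀ z, su2Inner z z = 1 →
      ∀ (α : Module.Dual ℝ V) (u v : D), P z α = u → su2Inner z (Ω u v) = α v := by
  have hF : ∀ i, su2Inner (F.basis i) (F.basis i) = 1 := fun i => by simp [F.orthonormal]
  have hrange : ∀ z, su2Inner z z = 1 → LinearMap.range (P z) = D := fun z hz => by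
    rw [hD]
    exact range_eq_of_ker_eq hskew fun α => ⟨fun h => hker z hz α h _, fun h => hker _ (hF 0) α h _⟩
  have hτ : ∀ i, ∃ τ : D →ₗ[ℝ] Module.Dual ℝ V, ∀ u, P (F.basis i) (τ u) = u := fun i => by
    obtain ⟨τ, hτ⟩ := (P (F.basis i)).rangeRestrict.exists_rightInverse_of_surjective
      (LinearMap.range_rangeRestrict _)
    refine ⟨τ ∘ₗ (LinearEquiv.ofEq _ _ (hrange _ (hF i)).symm).toLinearMap, fun u => ?_⟩
    exact congrArg Subtype.val (LinearMap.congr_fun hτ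
      (LinearEquiv.ofEq _ _ (hrange _ (hF i)).symm u))
  choose τ hτ using hτ
  let Ω : D →ₗ[ℝ] D →ₗ[ℝ] su2 :=
    ∑ i, ((τ i).compl₂ D.subtype).compr₂ (LinearMap.toSpanSingleton ℝ su2 (F.basis i))
  have hΩ : ∀ u v, Ω u v = ∑ i, τ i u v • F.basis i := fun u v => by
    simp [Ω]
  have hind : ∀ z, su2Inner z z = 1 → ∀ (α : Module.Dual ℝ V) (u v : D), P z α = u →
      su2Inner z (Ω u v) = α v := by
    intro z hz α u v h
    have h1 := hlin z hz α (fun i => τ i u) (fun i => h.trans (hτ i u).symm) z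
    rw [apply_eq_of_mem_range hskew h1 (by rw [hrange z hz]; exact v.2), hΩ]
    simp [mul_comm]
  have hflat : ∀ z, su2Inner z z = 1 → ∀ (α : Module.Dual ℝ V) (u : D),
      flat Ω z u = α ∘ₗ D.subtype ↔ P z α = u := by
    intro z hz α u
    constructor
    · intro h
      obtain ⟨β, hβ⟩ : (u : V) ∈ LinearMap.range (P z) := by
        rw [hrange z hz]
        exact u.2
      rw [← hβ]
      refine eq_of_apply_range_eq hskew fun v hv => ?_
      rw [hrange z hz] at hv
      rw [← hind z hz β u ⟨v, hv⟩ hβ]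
      exact (LinearMap.congr_fun h ⟨v, hv⟩).symm
    · exact fun h => LinearMap.ext fun v => hind z hz α u v h
  have hext : ∀ α : Module.Dual ℝ D, ∃ β : Module.Dual ℝ V, α = β ∘ₗ D.subtype := fun α => by
    obtain ⟨β, hβ⟩ := LinearMap.exists_extend α
    exact ⟨β, hβ.symm⟩
  have hbij : ∀ z, su2Inner z z = 1 → Function.Bijective (flat Ω z) := by
    intro z hz
    constructor
    · intro u u' h
      obtain ⟨β, hβ⟩ := hext (flat Ω z u')
      have h1 := (hflat z hz β u).1 (h.trans hβ)
      have h2 := (hflat z hz β u').1 hβ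
      exact Subtype.ext (h1.symm.trans h2)
    · intro α
      obtain ⟨β, rfl⟩ := hext α
      have hmem : P z β ∈ D := by
        rw [← hrange z hz]
        exact LinearMap.mem_range_self _ _
      exact ⟨⟨P z β, hmem⟩, (hflat z hz β _).2 rfl⟩
  refine ⟨Ω, ⟨fun v => ?_, fun ξ hξ => ?_, ?_⟩, hind⟩
  · rw [hΩ]
    refine Finset.sum_eq_zero fun i _ => ?_
    have h := hskew (F.basis i) (τ i v) (τ i v)
    rw [hτ] at h
    rw [show τ i v (v : V) = 0 by linarith, zero_smul]
  · have hpos : 0 < su2Inner ξ ξ := by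
      refine lt_of_le_of_ne ?_ fun h0 => hξ ?_
      · rw [F.inner_eq]
        exact Finset.sum_nonneg fun i _ => mul_self_nonneg _
      · rw [F.inner_eq, eq_comm, Finset.sum_eq_zero_iff_of_nonneg
          fun i _ => mul_self_nonneg _] at h0
        rw [← F.sum_inner_smul ξ]
        exact Finset.sum_eq_zero fun i hi => by rw [mul_self_eq_zero.1 (h0 i hi), zero_smul]
    -- Nondegeneracy for ξ ≠ 0 is reduced by scaling to the unit vector ξ/|ξ|.
    have hr : √(su2Inner ξ ξ) ≠ 0 := (Real.sqrt_pos.2 hpos).ne'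
    have hrr : √(su2Inner ξ ξ) * √(su2Inner ξ ξ) = su2Inner ξ ξ := Real.mul_self_sqrt hpos.le
    have hz : su2Inner ((√(su2Inner ξ ξ))⁻¹ • ξ) ((√(su2Inner ξ ξ))⁻¹ • ξ) = 1 := by
      simp only [map_smul, LinearMap.smul_apply, smul_eq_mul]
      field_simp
      linarith
    have hsc : ∀ u, flat Ω ξ u = √(su2Inner ξ ξ) • flat Ω ((√(su2Inner ξ ξ))⁻¹ • ξ) u :=
      fun u => by
        refine LinearMap.ext fun v => ?_
        simp only [flat, LinearMap.compr₂_apply, LinearMap.smul_apply, map_smul, smul_eq_mul]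
        field_simp
    have hb := hbij _ hz
    constructor
    · intro u u' h
      rw [hsc, hsc] at h
      exact hb.1 (smul_right_injective _ hr h)
    · intro α
      obtain ⟨u, hu⟩ := hb.2 ((√(su2Inner ξ ξ))⁻¹ • α)
      refine ⟨u, ?_⟩
      rw [hsc, hu, smul_smul, mul_inv_cancel₀ hr, one_smul]
  · intro ξ ξ₁ ξ₂ k₁ k₂ h h₁ h₂ hk α v v₁ v₂ hv hv₁ hv₂
    obtain ⟨β, rfl⟩ := hext α
    rw [hflat _ h] at hv
    rw [hflat _ h₁] at hv₁
    rw [hflat _ h₂] at hv₂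
    refine Subtype.ext ?_
    rw [Submodule.coe_add, Submodule.coe_smul, Submodule.coe_smul, ← hv, ← hv₁, ← hv₂, hk]
    simp

end Pointwise

/-! ### Transport of Poisson structures -/

namespace BivectorField

section Pullback

variable {V V' : Type*} [NormedAddCommGroup V] [NormedSpace ℝ V] [FiniteDimensional ℝ V]
  [NormedAddCommGroup V'] [NormedSpace ℝ V'] [FiniteDimensional ℝ V']
  {e : V ≃ₗ[ℝ] V'} {π : BivectorField V'} {W : Set V'}

theorem apply_sharp_pullback (m : V) (α : Module.Dual ℝ V) :
    e ((π.pullback e).sharp m α) = π.sharp (e m) (e.symm.dualMap α) := by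
  rw [← sub_eq_zero]
  refine (Module.forall_dual_apply_eq_zero_iff ℝ _).1 fun β => ?_
  have h := dual_sharp (π.pullback e) m α (e.dualMap β)
  have h' : (π.pullback e) m α (e.dualMap β) = π (e m) (e.symm.dualMap α) β := by
    change π (e m) (e.symm.dualMap α) (e.symm.dualMap (e.dualMap β)) = _
    congr 1
    ext x
    simp
  rw [map_sub, dual_sharp, ← h', ← h]
  exact sub_self _

omit [FiniteDimensional ℝ V] [FiniteDimensional ℝ V'] in
theorem IsPoissonOn.pullback_skew (hπ : π.IsPoissonOn W) {m : V} (hm : m ∈ e ⁻¹' W)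
    (α β : Module.Dual ℝ V) : π.pullback e m α β = -π.pullback e m β α :=
  hπ.skew _ hm _ _

omit [FiniteDimensional ℝ V'] in
theorem IsPoissonOn.pullback_smooth (hπ : π.IsPoissonOn W) (α β : Module.Dual ℝ V) :
    ContDiffOn ℝ ∞ (fun m => π.pullback e m α β) (e ⁻¹' W) :=
  ContDiffOn.comp (g := fun x => π x (e.symm.dualMap α) (e.symm.dualMap β)) (hπ.smooth _ _)
    (e.toContinuousLinearEquiv.contDiff.contDiffOn (s := e ⁻¹' W)) fun _ h => h

theorem IsPoissonOn.pullback_jacobi (hW : IsOpen W) (hπ : π.IsPoissonOn W) {m : V}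
    (hm : m ∈ e ⁻¹' W) (α β γ : Module.Dual ℝ V) :
    fderiv ℝ (fun x => π.pullback e x α β) m ((π.pullback e).sharp m γ) +
      fderiv ℝ (fun x => π.pullback e x β γ) m ((π.pullback e).sharp m α) +
      fderiv ℝ (fun x => π.pullback e x γ α) m ((π.pullback e).sharp m β) = 0 := by
  have h : ∀ (α β : Module.Dual ℝ V) (v : V), fderiv ℝ (fun x => π.pullback e x α β) m v =
      fderiv ℝ (fun x => π x (e.symm.dualMap α) (e.symm.dualMap β)) (e m) (e v) :=
    fun α β v => by
      have h1 : HasFDerivAt (fun x => π.pullback e x α β) _ m :=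
        HasFDerivAt.comp (g := fun x => π x (e.symm.dualMap α) (e.symm.dualMap β)) m
          (((hπ.smooth _ _).contDiffAt (hW.mem_nhds hm)).differentiableAt (by simp)).hasFDerivAt
          e.toContinuousLinearEquiv.hasFDerivAt
      rw [h1.fderiv]
      rfl
  rw [h, h, h, apply_sharp_pullback, apply_sharp_pullback, apply_sharp_pullback]
  exact hπ.jacobi_linear hm _ _ _

end Pullback

end BivectorField
end

noncomputable section

/-! ### The equivalence -/

section Main

variable {g : Type*} [LieRing g] [LieAlgebra ℝ g] [FiniteDimensional ℝ g]
  [LieAlgebra.IsSemisimple ℝ g] {U : Set (Triple g)} {A : Triple g → LinearMap.BilinForm ℝ g}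

namespace Frame

variable {F : Frame} {m : HomSU2 g}

theorem sharpFamily_skew (hUinv : ∀ O ∈ Matrix.specialOrthogonalGroup (Fin 3) ℝ, ∀ p ∈ U, p.act O ∈ U)
    (hPoisson : (tripleBivector A).IsPoissonOn U) (hm : m ∈ F.domain U)
    (z : su2) (α β : Module.Dual ℝ (HomSU2 g)) :
    β (F.sharpFamily A m z α) = -α (F.sharpFamily A m z β) := by
  have hskew : ∀ i, (F.cycle i).bivector A m α β = -(F.cycle i).bivector A m β α := fun i => by
    refine hPoisson.pullback_skew ?_ α β
    change m ∈ (F.cycle i).domain U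
    rwa [← domain_eq hUinv (cycle_orientation F i).symm]
  rw [sharpFamily_apply]
  simp only [LinearMap.sum_apply, LinearMap.smul_apply, map_sum, map_smul,
    BivectorField.dual_sharp, hskew, smul_neg, Finset.sum_neg_distrib]

theorem dist_eq_range_sharpFamily {T : Frame}
    (hAinv : ∀ O ∈ Matrix.specialOrthogonalGroup (Fin 3) ℝ, ∀ p ∈ U, A (p.act O) = A p)
    (h : F.basis.orientation = T.basis.orientation) (hm : m ∈ F.domain U) :
    (T.bivector A).dist m = LinearMap.range (F.sharpFamily A m (T.basis 0)) := by
  rw [BivectorField.dist, sharp_eq_sharpFamily hAinv h hm]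

/-- A frame rotated by `π / 4` about its third vector. -/
theorem exists_rotation (F : Frame) : ∃ T : Frame,
    F.basis.orientation = T.basis.orientation ∧
      T.basis 0 = (√2)⁻¹ • (F.basis 0 + F.basis 1) := by
  have h2 : √2 * √2 = (2 : ℝ) := Real.mul_self_sqrt (by norm_num)
  have h2' : √2 ≠ (0 : ℝ) := by positivity
  let T := ofOrthonormal ![(√2)⁻¹ • (F.basis 0 + F.basis 1), (√2)⁻¹ • (F.basis 1 - F.basis 0),
    F.basis 2] fun i j => by
      fin_cases i <;> fin_cases j <;> simp [F.orthonormal]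
      all_goals field_simp
      all_goals linarith
  refine ⟨T, ?_, by simp [T]⟩
  rw [Module.Basis.orientation_eq_iff_det_pos, det_eq, Matrix.det_fin_three]
  simp [T, F.orthonormal]

end Frame

/-- A single Ω for all frames makes ω_z linear in z, while P_z is linear too. Comparing the two at
(e₁ + e₂)/√2 gives the relations required by `exists_solvesSystem`. -/
theorem exists_solution_of_hypersymplectic {F : Frame} {m : HomSU2 g}
    (hUinv : ∀ O ∈ Matrix.specialOrthogonalGroup (Fin 3) ℝ, ∀ p ∈ U, p.act O ∈ U)
    (hAinv : ∀ O ∈ Matrix.specialOrthogonalGroup (Fin 3) ℝ, ∀ p ∈ U, A (p.act O) = A p)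
    (hPoisson : (tripleBivector A).IsPoissonOn U) (hm : m ∈ F.domain U)
    (hdist : ∀ T : Frame, F.basis.orientation = T.basis.orientation →
      (F.bivector A).dist m = (T.bivector A).dist m)
    (hΩ : HypersymplecticLeaf F.basis.orientation A U F m) (ξ : g) :
    ∃ u v w, SolvesSystem (A (F.identify m)) (F.identify m 0) (F.identify m 1) (F.identify m 2)
      ξ u v w := by
  obtain ⟨Ω, -, hind⟩ := hΩ
  have hskew := F.sharpFamily_skew hUinv hPoisson hm
  have hmL : m ∈ F.leaf A U m := Relation.ReflTransGen.refl
  have hD : ∀ T : Frame, F.basis.orientation = T.basis.orientation →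
      LinearMap.range (F.sharpFamily A m (T.basis 0)) = (F.bivector A).dist m := fun T hT => by
    rw [hdist T hT, Frame.dist_eq_range_sharpFamily hAinv hT hm]
  have hI : ∀ (T : Frame), F.basis.orientation = T.basis.orientation →
      ∀ (i : Fin 3) (α : Module.Dual ℝ (HomSU2 g)) (u v : (F.bivector A).dist m),
      F.sharpFamily A m (T.basis i) α = u → su2Inner (T.basis i) (Ω m u v) = α v := by
    intro T hT i α u v h
    refine hind T hT.symm i m hmL α u v ?_
    rw [Frame.sharp_eq_sharpFamily hAinv (hT.trans (T.cycle_orientation i).symm) hm,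
      Frame.cycle_basis_zero, h]
  refine Frame.exists_solvesSystem hAinv hm (fun α => ?_) ξ
  obtain ⟨T, hT, hT0⟩ := F.exists_rotation
  have hu : F.sharpFamily A m (F.basis 0) α ∈ (F.bivector A).dist m := by
    rw [← hD F rfl]
    exact LinearMap.mem_range_self _ _
  obtain ⟨α', hα'⟩ : F.sharpFamily A m (F.basis 0) α ∈
      LinearMap.range (F.sharpFamily A m (F.basis 1)) := by
    rw [← F.cycle_basis_zero 1, hD _ (F.cycle_orientation 1).symm]
    exact hu
  obtain ⟨β, hβ⟩ : F.sharpFamily A m (F.basis 0) α ∈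
      LinearMap.range (F.sharpFamily A m (T.basis 0)) := by
    rw [hD T hT]
    exact hu
  refine ⟨α', hα'.symm, ?_⟩
  -- β and (α + α')/√2 agree on the tangent space, since both restrict to ω_t(u, ·) for t = (e₁ +
  -- e₂)/√2.
  have hsum : F.sharpFamily A m (T.basis 0) β =
      F.sharpFamily A m (T.basis 0) ((√2)⁻¹ • (α + α')) := by
    refine eq_of_apply_range_eq hskew fun v hv => ?_
    rw [hD T hT] at hv
    have h0 := hI F rfl 0 α ⟨_, hu⟩ ⟨v, hv⟩ rfl
    have h1 := hI F rfl 1 α' ⟨_, hu⟩ ⟨v, hv⟩ hα'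
    have h2 := hI T hT 0 β ⟨_, hu⟩ ⟨v, hv⟩ hβ
    rw [hT0] at h2
    simp only [map_smul, map_add, LinearMap.smul_apply, LinearMap.add_apply, h0, h1] at h2 ⊢
    exact h2.symm
  have h22 : (√2)⁻¹ * (√2)⁻¹ = (1 / 2 : ℝ) := by
    rw [← mul_inv, Real.mul_self_sqrt (by norm_num)]
    norm_num
  -- With u = P_{e₁}α = P_{e₂}α' this reads u = ½(u + P_{e₁}α' + P_{e₂}α + u).
  rw [hβ, hT0] at hsum
  simp only [map_smul, map_add, LinearMap.smul_apply, LinearMap.add_apply, hα', smul_smul,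
    ← smul_add, h22] at hsum
  have h3 := congrArg (fun v => (2 : ℝ) • v) hsum
  simp only [smul_smul] at h3
  norm_num at h3
  rw [two_smul] at h3
  rw [eq_neg_iff_add_eq_zero]
  have h4 := sub_eq_zero.2 h3
  rw [← neg_eq_zero, ← h4]
  abel

theorem exists_hypersymplectic_form {F : Frame} {m : HomSU2 g}
    (hUinv : ∀ O ∈ Matrix.specialOrthogonalGroup (Fin 3) ℝ, ∀ p ∈ U, p.act O ∈ U)
    (hAinv : ∀ O ∈ Matrix.specialOrthogonalGroup (Fin 3) ℝ, ∀ p ∈ U, A (p.act O) = A p)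
    (hAsymm : ∀ p ∈ U, ∀ ξ η : g, A p ξ η = A p η ξ)
    (hPoisson : (tripleBivector A).IsPoissonOn U)
    (hsys : ∀ p ∈ U, ∀ ξ : g, ∃ u v w : g, SolvesSystem (A p) (p 0) (p 1) (p 2) ξ u v w)
    (hm : m ∈ F.domain U) :
    ∃ Ω : (F.bivector A).dist m →ₗ[ℝ] (F.bivector A).dist m →ₗ[ℝ] su2,
      IsHypersymplecticAt Ω ∧ ∀ z, su2Inner z z = 1 → ∀ (α : Module.Dual ℝ (HomSU2 g))
        (u v : (F.bivector A).dist m), F.sharpFamily A m z α = u → su2Inner z (Ω u v) = α v :=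
  exists_isHypersymplecticAt F (F.sharpFamily_skew hUinv hPoisson hm)
    (fun _ hz _ h w => Frame.sharpFamily_ker hAinv hm (hAsymm _ hm) (hsys _ hm) hz h w)
    (fun _ hz _ _ h w => Frame.sharpFamily_inverse_linear hAinv hm (hAsymm _ hm) (hsys _ hm) hz h w)
    (Frame.dist_eq_range_sharpFamily hAinv rfl hm)

theorem dist_eq_of_solvable {F T : Frame} {m : HomSU2 g}
    (hUinv : ∀ O ∈ Matrix.specialOrthogonalGroup (Fin 3) ℝ, ∀ p ∈ U, p.act O ∈ U)
    (hAinv : ∀ O ∈ Matrix.specialOrthogonalGroup (Fin 3) ℝ, ∀ p ∈ U, A (p.act O) = A p)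
    (hAsymm : ∀ p ∈ U, ∀ ξ η : g, A p ξ η = A p η ξ)
    (hPoisson : (tripleBivector A).IsPoissonOn U)
    (hsys : ∀ p ∈ U, ∀ ξ : g, ∃ u v w : g, SolvesSystem (A p) (p 0) (p 1) (p 2) ξ u v w)
    (hT : F.basis.orientation = T.basis.orientation) (hm : m ∈ F.domain U) :
    (F.bivector A).dist m = (T.bivector A).dist m := by
  rw [Frame.dist_eq_range_sharpFamily hAinv rfl hm, Frame.dist_eq_range_sharpFamily hAinv hT hm]
  have hker := fun z hz α h w => Frame.sharpFamily_ker hAinv hm (hAsymm _ hm) (hsys _ hm)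
    (z := z) hz (α := α) h w
  exact range_eq_of_ker_eq (F.sharpFamily_skew hUinv hPoisson hm) fun α =>
    ⟨fun h => hker _ (by simp [F.orthonormal]) α h _,
      fun h => hker _ (by simp [T.orthonormal]) α h _⟩

theorem hypersymplecticLeaf_of_solvable {F : Frame} {m : HomSU2 g} (hU : IsOpen U)
    (hUinv : ∀ O ∈ Matrix.specialOrthogonalGroup (Fin 3) ℝ, ∀ p ∈ U, p.act O ∈ U)
    (hAinv : ∀ O ∈ Matrix.specialOrthogonalGroup (Fin 3) ℝ, ∀ p ∈ U, A (p.act O) = A p)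
    (hAsymm : ∀ p ∈ U, ∀ ξ η : g, A p ξ η = A p η ξ)
    (hPoisson : (tripleBivector A).IsPoissonOn U)
    (hsys : ∀ p ∈ U, ∀ ξ : g, ∃ u v w : g, SolvesSystem (A p) (p 0) (p 1) (p 2) ξ u v w)
    (hm : m ∈ F.domain U) : HypersymplecticLeaf F.basis.orientation A U F m := by
  have hex : ∀ x, ∃ Ω : (F.bivector A).dist x →ₗ[ℝ] (F.bivector A).dist x →ₗ[ℝ] su2,
      x ∈ F.domain U → IsHypersymplecticAt Ω ∧ ∀ z, su2Inner z z = 1 →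
        ∀ (α : Module.Dual ℝ (HomSU2 g)) (u v : (F.bivector A).dist x),
          F.sharpFamily A x z α = u → su2Inner z (Ω u v) = α v := fun x => by
    by_cases hx : x ∈ F.domain U
    · obtain ⟨Ω, hΩ⟩ := exists_hypersymplectic_form hUinv hAinv hAsymm hPoisson hsys hx
      exact ⟨Ω, fun _ => hΩ⟩
    · exact ⟨0, fun h => absurd h hx⟩
  choose Ω hΩ using hex
  have hsub : F.leaf A U m ⊆ F.domain U := leaf_subset hm
  refine ⟨Ω, ⟨fun x hx => (hΩ x (hsub hx)).1, fun k S φ hφ _ ξ => ?_⟩, ?_⟩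
  · have hdist : ∀ i, ∀ x ∈ F.domain U,
        (F.bivector A).dist x = ((F.cycle i).bivector A).dist x := fun i x hx =>
      dist_eq_of_solvable hUinv hAinv hAsymm hPoisson hsys (F.cycle_orientation i).symm hx
    have hopen : IsOpen (F.domain U) :=
      hU.preimage (F.identify (g := g)).toContinuousLinearEquiv.continuous
    have hdom : ∀ i, F.domain U = (F.cycle i).identify ⁻¹' U := fun i =>
      Frame.domain_eq hUinv (F.cycle_orientation i).symm
    have hform : ∀ i, ∃ η : EuclideanSpace ℝ (Fin k) → EuclideanSpace ℝ (Fin k) [⋀^Fin 2]→L[ℝ] ℝ,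
        (∀ s ∈ S, ∀ (x y : EuclideanSpace ℝ (Fin k)) (α : Module.Dual ℝ (HomSU2 g)),
          ((F.cycle i).bivector A).sharp (φ s) α = fderiv ℝ φ s x →
            η s ![x, y] = α (fderiv ℝ φ s y)) ∧
        ContDiffOn ℝ ∞ η S ∧ ∀ s ∈ S, extDeriv η s = 0 := fun i => by
      refine BivectorField.exists_closed_form (π := (F.cycle i).bivector A) hopen ?_ ?_ ?_
        (hφ.congr (hdist i))
      · rw [hdom i]
        exact hPoisson.pullback_smooth
      · rw [hdom i]
        exact fun x hx => hPoisson.pullback_skew hx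
      · rw [hdom i]
        exact fun x hx => hPoisson.pullback_jacobi hU hx
    choose η hη hsm hcl using hform
    -- ⟨ξ, Ω⟩ = ∑ ⟨ξ, e_i⟩ ω_i is a constant combination of the closed forms of the three cyclic
    -- frames.
    refine ⟨fun s => ∑ i, su2Inner ξ (F.basis i) • η i s, fun s hs x y u v hu hv => ?_,
      ContDiffOn.sum fun i _ => (hsm i).const_smul _, fun s hs => ?_⟩
    · have hφs : φ s ∈ F.domain U := hφ.mapsTo hs
      rw [F.inner_eq, ContinuousAlternatingMap.sum_apply]
      refine Finset.sum_congr rfl fun i _ => ?_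
      obtain ⟨α, hα⟩ : (u : HomSU2 g) ∈ ((F.cycle i).bivector A).dist (φ s) := by
        rw [← hdist i _ hφs]
        exact u.2
      rw [ContinuousAlternatingMap.smul_apply, hη i s hs x y α (hα.trans hu), smul_eq_mul,
        su2Inner_comm (Ω _ _ _), (hΩ _ hφs).2 _ (by simp [F.orthonormal]) α u v, hv]
      rw [← hα, Frame.sharp_eq_sharpFamily hAinv (F.cycle_orientation i).symm hφs,
        Frame.cycle_basis_zero]
    · have hd : ∀ i, DifferentiableAt ℝ (η i) s := fun i =>
        ((hsm i).contDiffAt (hφ.isOpen.mem_nhds hs)).differentiableAt (by simp)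
      have h0 : extDeriv (fun s => ∑ i, su2Inner ξ (F.basis i) • η i s) s =
          ∑ i, su2Inner ξ (F.basis i) • extDeriv (η i) s := by
        have he : (fun s => ∑ i, su2Inner ξ (F.basis i) • η i s) = su2Inner ξ (F.basis 0) • η 0 +
            su2Inner ξ (F.basis 1) • η 1 + su2Inner ξ (F.basis 2) • η 2 := by
          funext s
          simp only [Fin.sum_univ_three, Pi.add_apply, Pi.smul_apply]
        rw [he, extDeriv_add (((hd 0).const_smul _).add ((hd 1).const_smul _))
          ((hd 2).const_smul _), extDeriv_add ((hd 0).const_smul _) ((hd 1).const_smul _),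
          extDeriv_smul, extDeriv_smul, extDeriv_smul, Fin.sum_univ_three]
      rw [h0]
      exact Finset.sum_eq_zero fun i _ => by rw [hcl i s hs, smul_zero]
  · intro T hT i x hx α u v h
    refine (hΩ x (hsub hx)).2 _ (by simp [T.orthonormal]) α u v ?_
    rw [← h, Frame.sharp_eq_sharpFamily hAinv (hT.symm.trans (T.cycle_orientation i).symm)
      (hsub hx), Frame.cycle_basis_zero]

end Main

end

theorem theorem3 {g : Type*} [LieRing g] [LieAlgebra ℝ g] [FiniteDimensional ℝ g]
    [LieAlgebra.IsSemisimple ℝ g]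
    (o : Orientation ℝ su2 (Fin 3))
    (U : Set (Triple g)) (hU : IsOpen U)
    (hUinv : ∀ O ∈ Matrix.specialOrthogonalGroup (Fin 3) ℝ, ∀ p ∈ U, p.act O ∈ U)
    (A : Triple g → LinearMap.BilinForm ℝ g)
    (hAsymm : ∀ p ∈ U, ∀ ξ η : g, A p ξ η = A p η ξ)
    (hAsmooth : ∀ ξ η : g, ContDiffOn ℝ ∞ (fun p => A p ξ η) U)
    (hAinv : ∀ O ∈ Matrix.specialOrthogonalGroup (Fin 3) ℝ, ∀ p ∈ U, A (p.act O) = A p)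
    (hPoisson : (tripleBivector A).IsPoissonOn U) :
    ((∀ F T : Frame, F.basis.orientation = o → T.basis.orientation = o → SameFoliation A U F T) ∧
      (∀ F : Frame, F.basis.orientation = o → ∀ m ∈ F.domain U, HypersymplecticLeaf o A U F m)) ↔
    (∀ p ∈ U, ∀ ξ : g, ∃ u v w : g, SolvesSystem (A p) (p 0) (p 1) (p 2) ξ u v w) := by
  constructor
  · rintro ⟨hfol, hhyp⟩ p hp ξ
    -- One oriented frame suffices: its identification reaches every point of U.
    obtain ⟨F, rfl⟩ := Frame.exists_orientation_eq o
    have hm : F.identify.symm p ∈ F.domain U := by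
      change F.identify (F.identify.symm p) ∈ U
      rwa [LinearEquiv.apply_symm_apply]
    have h := exists_solution_of_hypersymplectic hUinv hAinv hPoisson hm
      (fun T hT => (hfol F T rfl hT.symm _ hm).2) (hhyp F rfl _ hm) ξ
    rwa [LinearEquiv.apply_symm_apply] at h
  · refine fun hsys => ⟨fun F T hF hT m hm => ?_, fun F hF m hm => ?_⟩
    · have hFT : F.basis.orientation = T.basis.orientation := hF.trans hT.symm
      have hdist : ∀ x ∈ F.domain U, (F.bivector A).dist x = (T.bivector A).dist x := fun x hx =>
        dist_eq_of_solvable hUinv hAinv hAsymm hPoisson hsys hFT hx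
      refine ⟨?_, hdist m hm⟩
      unfold Frame.leaf
      rw [leaf_congr hdist, Frame.domain_eq hUinv hFT]
    · subst hF
      exact hypersymplecticLeaf_of_solvable hU hUinv hAinv hAsymm hPoisson hsys hm
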